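/- Let $k$ be a commutative ring and $R$ a $k$-algebra; all bimodules are $k$-central. For an $R$-bimodule $M$ put $M^*=\mathrm{Hom}_R(M,R)$ (right $R$-linear maps), a bimodule by $(r\varphi)(m)=r\varphi(m)$, $(\varphi r)(m)=\varphi(rm)$. Let $\mathcal C$ be a monoidal category with unit $I$ and let $F:\mathcal C\to R\text{-Bimod}$ be a monoidal functor, with isomorphisms $\theta_{X,Y}:F(X)\otimes_RF(Y)\cong F(X\otimes Y)$ and $\eta:F(I)\cong R$, such that every $F(X)$ is left rigid, i.e. finitely generated projective as a right $R$-module. Let $L=\mathrm{Coend}(F)$ be the quotient of $\bigoplus_{X}F(X)^*\otimes_kF(X)$ by the relations $\varphi F(f)\otimes m=\varphi\otimes F(f)m$ for $f:X\to Y$, $\varphi\in F(Y)^*$, $m\in F(X)$; write $[\varphi\otimes m]_X$ for the class of $\varphi\otimes m$. $L$ carries two commuting $R$-bimodule structures $\sigma,\tau$: $\sigma(a)[\varphi\otimes m]\sigma(b)=[a\varphi b\otimes m]$, $\tau(a)[\varphi\otimes m]\tau(b)=[\varphi\otimes amb]$. A sub- or superscript on either side of $\otimes$ names the right (sub) or left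 (super) action that is balanced: $L\,{}_\tau\!\otimes^\sigma L$, $L\,{}^\sigma\!\otimes_\sigma L$, $L\,{}_\tau\!\otimes^\tau L$ are the quotients of $L\otimes_kL$ by $h\tau(a)\otimes g=h\otimes\sigma(a)g$, by $\sigma(a)h\otimes g=h\otimes g\sigma(a)$ and by $h\tau(a)\otimes g=h\otimes\tau(a)g$, respectively; $L\boxtimes L$ is the quotient by $\sigma(a)h\tau(b)\otimes g=h\otimes\tau(b)g\sigma(a)$. An $R$-coalgebroid is a double $R$-bimodule $L$ with a double bimodule map $\Delta:L\to L\,{}_\tau\!\otimes^\sigma L$ (where $\sigma$ acts on the first and $\tau$ on the second factor) and a $k$-linear $\varepsilon:L\to R$ which are coassociative and counital, with $\varepsilon(\sigma(a)h\tau(b))=a\varepsilon(h)b$ and $\varepsilon(\tau(a)h)=\varepsilon(h\sigma(a))$. An $R$-bialgebroid is a monoid in the category of coalgebroids for $\boxtimes$ and $R\otimes_kR$: it has double bimodule maps $m:L\boxtimes L\to L$, $h\circ g=m(h\boxtimes g)$, where $\sigma(a)(h\boxtimes g)\sigma(b)=h\sigma(b)\boxtimes\sigma(a)g$ and $\tau(a)(h\boxtimes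 g)\tau(b)=\tau(a)h\boxtimes g\tau(b)$, and $u:R\otimes_kR\to L$, where $\sigma(a)\tau(b)(x\otimes y)\sigma(c)\tau(d)=axc\otimes byd$, such that $\circ$ is associative, $h\circ u(a\otimes b)=\sigma(a)h\tau(b)$, $u(a\otimes b)\circ h=\tau(b)h\sigma(a)$, $\Delta(h\circ g)=\sum h_{(1)}\circ g_{(1)}\otimes h_{(2)}\circ g_{(2)}$, $\varepsilon(h\circ g)=\varepsilon(g\sigma(\varepsilon(h)))$, $\Delta(u(a\otimes b))=u(a\otimes1)\otimes u(1\otimes b)$ and $\varepsilon(u(a\otimes b))=ab$. Put $1=u(1\otimes1)$. It is a Hopf algebroid if it has an antipode, i.e. a $k$-linear map $\nabla:L\to L\,{}^\sigma\!\otimes_\sigma L$, $\nabla(h)=\sum h^-\otimes h^+$, with $$\sum h^-\circ h^+{}_{(1)}\otimes h^+{}_{(2)}=1\otimes h\in L\,{}_\tau\!\otimes^\sigma L,\qquad \sum h_{(1)}\circ h_{(2)}{}^-\otimes h_{(2)}{}^+=1\otimes h\in L\,{}^\sigma\!\otimes_\sigma L,$$ and an opposite Hopf algebroid if it has an opposite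 antipode, i.e. a $k$-linear map $\nabla^{\rm op}:L\to L\,{}_\tau\!\otimes^\tau L$, $\nabla^{\rm op}(h)=\sum h_-\otimes h_+$, with $$\sum h_{+(1)}\otimes h_-\circ h_{+(2)}=h\otimes1\in L\,{}_\tau\!\otimes^\sigma L,\qquad \sum h_{(2)}\circ h_{(1)-}\otimes h_{(1)+}=1\otimes h\in L\,{}_\tau\!\otimes^\tau L.$$ Theorem. (1) $L$ is an $R$-bialgebroid, with $\varepsilon[\varphi\otimes m]=\varphi(m)$; with $\Delta[\varphi\otimes m]_X=\sum_i[\varphi\otimes m_i]_X\otimes[\varphi^i\otimes m]_X$ for all dual bases $m_i,\varphi^i$ of $F(X)$ (that is, $x=\sum_i m_i\varphi^i(x)$ for all $x$); with product $[\varphi\otimes m]_X\circ[\psi\otimes n]_Y=[\chi\theta_{X,Y}^{-1}\otimes\theta_{X,Y}(m\otimes n)]_{X\otimes Y}$, $\chi(x\otimes y)=\psi(\varphi(x)y)$; and with unit $u(a\otimes b)=[a\eta\otimes\eta^{-1}(b)]_I$. (2) If $\mathcal C$ is left rigid (every $X$ has a left dual $X^*$ with $\mathrm{ev}:X^*\otimes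 X\to I$, $\mathrm{db}:I\to X\otimes X^*$), then $L$ is a Hopf algebroid. For $\xi\in F(X^*)$ let $\hat\xi\in F(X)^*$ be $\hat\xi(m)=\eta(F(\mathrm{ev})(\theta(\xi\otimes m)))$; the antipode is given by $\nabla[\hat\xi\otimes m]_X=\sum_j[\eta^j\otimes\xi]_{X^*}\otimes[\hat\varphi_j\otimes m]_X$ for all dual bases $\varphi_j,\eta^j$ of $F(X^*)$. (3) If $\mathcal C$ is right rigid (every $X$ has a right dual ${}^*X$ with $\mathrm{ev}:X\otimes{}^*X\to I$, $\mathrm{db}:I\to{}^*X\otimes X$), then $L$ is an opposite Hopf algebroid. For $m\in F(X)$ let $\hat m\in F({}^*X)^*$ be $\hat m(y)=\eta(F(\mathrm{ev})(\theta(m\otimes y)))$; the opposite antipode is given by $\nabla^{\rm op}[\varphi\otimes m]_X=\sum_j[\hat m\otimes f_j]_{{}^*X}\otimes[\varphi\otimes g_j]_X$ for all $f_j\in F({}^*X)$, $g_j\in F(X)$ such that $f_j,\hat g_j$ are dual bases of $F({}^*X)$. -/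

import Mathlib

open CategoryTheory MonoidalCategory MulOpposite
open scoped TensorProduct

namespace Tannaka

universe u v w w₁ w₂ w₃ w₄ w₅

/-! ### Balanced tensor products over `k` -/

section Balanced

variable {k : Type u} [CommRing k] {ι : Type v}
  {M : Type w₁} [AddCommGroup M] [Module k M] {N : Type w₂} [AddCommGroup N] [Module k N]
  {M' : Type w₃} [AddCommGroup M'] [Module k M'] {N' : Type w₄} [AddCommGroup N'] [Module k N']
  {A : Type w₅} [AddCommGroup A] [Module k A]

/-- The relations `f i m ⊗ n = m ⊗ g i n` in `M ⊗ₖ N`. -/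
def balRel (f : ι → Module.End k M) (g : ι → Module.End k N) : Submodule k (M ⊗[k] N) :=
  Submodule.span k {z | ∃ i m n, z = f i m ⊗ₜ[k] n - m ⊗ₜ[k] g i n}

/-- The quotient of `M ⊗ₖ N` by the relations `f i m ⊗ n = m ⊗ g i n`. -/
abbrev Bal (f : ι → Module.End k M) (g : ι → Module.End k N) : Type (max w₁ w₂) :=
  (M ⊗[k] N) ⧸ balRel f g

/-- The quotient map `M ⊗ₖ N → Bal f g`. -/
def Bal.mk (f : ι → Module.End k M) (g : ι → Module.End k N) : M ⊗[k] N →ₗ[k] Bal f g :=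
  (balRel f g).mkQ

variable {f : ι → Module.End k M} {g : ι → Module.End k N}
  {f' : ι → Module.End k M'} {g' : ι → Module.End k N'}

/-- The class of `m ⊗ n`. -/
def Bal.tmul (f : ι → Module.End k M) (g : ι → Module.End k N) (m : M) (n : N) : Bal f g :=
  Bal.mk f g (m ⊗ₜ[k] n)

theorem Bal.tmul_bal (i : ι) (m : M) (n : N) :
    Bal.tmul f g (f i m) n = Bal.tmul f g m (g i n) :=
  (Submodule.Quotient.eq _).2 (Submodule.subset_span ⟨i, m, n, rfl⟩)

@[simp] theorem Bal.mk_tmul (m : M) (n : N) : Bal.mk f g (m ⊗ₜ[k] n) = Bal.tmul f g m n := rfl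

/-- Balanced linear maps factor through the quotient. -/
def Bal.lift (φ : M ⊗[k] N →ₗ[k] A)
    (h : ∀ i m n, φ (f i m ⊗ₜ[k] n) = φ (m ⊗ₜ[k] g i n)) : Bal f g →ₗ[k] A :=
  (balRel f g).liftQ φ (by
    refine Submodule.span_le.2 ?_
    rintro _ ⟨i, m, n, rfl⟩
    simp [h])

@[simp] theorem Bal.lift_tmul (φ : M ⊗[k] N →ₗ[k] A)
    (h : ∀ i m n, φ (f i m ⊗ₜ[k] n) = φ (m ⊗ₜ[k] g i n)) (m : M) (n : N) :
    Bal.lift φ h (Bal.tmul f g m n) = φ (m ⊗ₜ[k] n) := rfl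

theorem Bal.hom_ext {φ ψ : Bal f g →ₗ[k] A}
    (h : ∀ m n, φ (Bal.tmul f g m n) = ψ (Bal.tmul f g m n)) : φ = ψ :=
  Submodule.linearMap_qext _ (TensorProduct.ext' h)

theorem Bal.ind {p : Bal f g → Prop} (tmul : ∀ m n, p (Bal.tmul f g m n))
    (add : ∀ x y, p x → p y → p (x + y)) (z : Bal f g) : p z := by
  obtain ⟨z, rfl⟩ := Submodule.mkQ_surjective _ z
  induction z using TensorProduct.induction_on with
  | zero =>
    have h := tmul 0 0
    rwa [Bal.tmul, TensorProduct.zero_tmul, map_zero, ← map_zero (balRel f g).mkQ] at h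
  | tmul x y => exact tmul x y
  | add x y hx hy => rw [map_add]; exact add _ _ hx hy

/-- A family of operators `μ a` on the left factor, which respects the relations, acts on the
balanced tensor product by `μ a (m ⊗ n) = μ a m ⊗ n`. -/
def Bal.actL (μ : A →ₗ[k] M →ₗ[k] M') (h : ∀ a i m, μ a (f i m) = f' i (μ a m)) :
    A →ₗ[k] Bal f g →ₗ[k] Bal f' g where
  toFun a := Bal.lift (Bal.mk f' g ∘ₗ LinearMap.rTensor N (μ a)) (fun i m n => by
    simpa [h] using Bal.tmul_bal (f := f') (g := g) i (μ a m) n)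
  map_add' a b := Bal.hom_ext fun m n => by
    simp [LinearMap.rTensor_add]
  map_smul' c a := Bal.hom_ext fun m n => by
    simp [LinearMap.rTensor_smul]

@[simp] theorem Bal.actL_tmul (μ : A →ₗ[k] M →ₗ[k] M') (h : ∀ a i m, μ a (f i m) = f' i (μ a m))
    (a : A) (m : M) (n : N) :
    Bal.actL (g := g) μ h a (Bal.tmul f g m n) = Bal.tmul f' g (μ a m) n := rfl

/-- A family of operators `μ a` on the right factor, which respects the relations, acts on the
balanced tensor product by `μ a (m ⊗ n) = m ⊗ μ a n`. -/
def Bal.actR (μ : A →ₗ[k] N →ₗ[k] N') (h : ∀ a i n, μ a (g i n) = g' i (μ a n)) :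
    A →ₗ[k] Bal f g →ₗ[k] Bal f g' where
  toFun a := Bal.lift (Bal.mk f g' ∘ₗ LinearMap.lTensor M (μ a)) (fun i m n => by
    simpa [h] using Bal.tmul_bal (f := f) (g := g') i m (μ a n))
  map_add' a b := Bal.hom_ext fun m n => by
    simp
  map_smul' c a := Bal.hom_ext fun m n => by
    simp

@[simp] theorem Bal.actR_tmul (μ : A →ₗ[k] N →ₗ[k] N') (h : ∀ a i n, μ a (g i n) = g' i (μ a n))
    (a : A) (m : M) (n : N) :
    Bal.actR (f := f) μ h a (Bal.tmul f g m n) = Bal.tmul f g' m (μ a n) := rfl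

end Balanced

/-! ### `R`-bimodules and their tensor product -/

/-- An `R`-bimodule on which `k` acts centrally. The right action of `r` is that of
`op r : Rᵐᵒᵖ`. -/
structure RBimod (k : Type u) (R : Type w) [CommRing k] [Ring R] [Algebra k R] where
  /-- the underlying type -/
  carrier : Type w
  [addCommGroup : AddCommGroup carrier]
  [module : Module k carrier]
  [leftModule : Module R carrier]
  [rightModule : Module Rᵐᵒᵖ carrier]
  [smulComm : SMulCommClass R Rᵐᵒᵖ carrier]
  [leftTower : IsScalarTower k R carrier]
  [rightTower : IsScalarTower k Rᵐᵒᵖ carrier]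

section Bimodules

variable {k : Type u} {R : Type w} [CommRing k] [Ring R] [Algebra k R]

namespace RBimod

instance : CoeSort (RBimod k R) (Type w) := ⟨RBimod.carrier⟩

attribute [instance] addCommGroup module leftModule rightModule smulComm leftTower rightTower

/-- Morphisms of `R`-bimodules: maps which are linear for both actions (and for `k`). -/
@[ext] structure Hom (M N : RBimod k R) where
  /-- the underlying map -/
  lin : M →ₗ[k] N
  map_left : ∀ (r : R) (x : M), lin (r • x) = r • lin x
  map_right : ∀ (r : R) (x : M), lin (op r • x) = op r • lin x

instance : Category (RBimod k R) where
  Hom M N := Hom M N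
  id M := ⟨LinearMap.id, fun _ _ => rfl, fun _ _ => rfl⟩
  comp f g := ⟨g.lin ∘ₗ f.lin, fun r x => by simp [f.map_left, g.map_left],
    fun r x => by simp [f.map_right, g.map_right]⟩

/-- The left action `m ↦ r m`. -/
def lact (M : RBimod k R) : R →ₗ[k] Module.End k M :=
  LinearMap.mk₂ k (fun r m => r • m) (fun _ _ _ => add_smul _ _ _) (fun _ _ _ => smul_assoc _ _ _)
    (fun _ _ _ => smul_add _ _ _) (fun c r m => by
      rw [← algebraMap_smul R c m, ← algebraMap_smul R c (r • m), smul_smul, smul_smul,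
        Algebra.commutes])

/-- The right action `m ↦ m r`. -/
def ract (M : RBimod k R) : R →ₗ[k] Module.End k M :=
  LinearMap.mk₂ k (fun r m => op r • m) (fun _ _ _ => by rw [MulOpposite.op_add, add_smul])
    (fun c r m => by rw [op_smul, smul_assoc])
    (fun _ _ _ => smul_add _ _ _) (fun c r m => by
      rw [← algebraMap_smul Rᵐᵒᵖ c m, ← algebraMap_smul Rᵐᵒᵖ c (op r • m), smul_smul, smul_smul,
        Algebra.commutes])

@[simp] theorem lact_apply (M : RBimod k R) (r : R) (m : M) : M.lact r m = r • m := rfl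
@[simp] theorem ract_apply (M : RBimod k R) (r : R) (m : M) : M.ract r m = op r • m := rfl

/-- `R` as a bimodule over itself. -/
def unit (k : Type u) (R : Type w) [CommRing k] [Ring R] [Algebra k R] : RBimod k R where
  carrier := R

/-- The underlying `k`-module of `M ⊗_R N`. -/
abbrev Tens (M N : RBimod k R) : Type w := Bal (fun r => M.ract r) (fun r => N.lact r)

/-- `m ⊗ n` in `M ⊗_R N`. -/
abbrev tmul {M N : RBimod k R} (m : M) (n : N) : M.Tens N :=
  Bal.tmul (fun r => M.ract r) (fun r => N.lact r) m n

/-- The left action `r (m ⊗ n) = r m ⊗ n`. -/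
def tensL (M N : RBimod k R) : R →ₗ[k] Module.End k (M.Tens N) :=
  Bal.actL M.lact (fun a r m => by simp [smul_comm])

/-- The right action `(m ⊗ n) r = m ⊗ n r`. -/
def tensR (M N : RBimod k R) : R →ₗ[k] Module.End k (M.Tens N) :=
  Bal.actR N.ract (fun a r m => by simp [smul_comm])

@[simp] theorem tensL_tmul {M N : RBimod k R} (r : R) (m : M) (n : N) :
    M.tensL N r (tmul m n) = tmul (r • m) n := rfl
@[simp] theorem tensR_tmul {M N : RBimod k R} (r : R) (m : M) (n : N) :
    M.tensR N r (tmul m n) = tmul m (op r • n) := rfl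

theorem tensL_one (M N : RBimod k R) : M.tensL N 1 = LinearMap.id :=
  Bal.hom_ext fun m n => by rw [tensL_tmul, one_smul]; rfl
theorem tensL_mul (M N : RBimod k R) (a b : R) :
    M.tensL N (a * b) = M.tensL N a ∘ₗ M.tensL N b :=
  Bal.hom_ext fun m n => by
    rw [LinearMap.comp_apply, tensL_tmul, tensL_tmul, tensL_tmul, mul_smul]
theorem tensR_one (M N : RBimod k R) : M.tensR N 1 = LinearMap.id :=
  Bal.hom_ext fun m n => by rw [tensR_tmul, op_one, one_smul]; rfl
theorem tensR_mul (M N : RBimod k R) (a b : R) :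
    M.tensR N (a * b) = M.tensR N b ∘ₗ M.tensR N a :=
  Bal.hom_ext fun m n => by
    rw [LinearMap.comp_apply, tensR_tmul, tensR_tmul, tensR_tmul, op_mul, mul_smul]
theorem tensL_tensR (M N : RBimod k R) (a b : R) :
    M.tensL N a ∘ₗ M.tensR N b = M.tensR N b ∘ₗ M.tensL N a :=
  Bal.hom_ext fun m n => by simp

/-- The bimodule `M ⊗_R N`. -/
def tensor (M N : RBimod k R) : RBimod k R :=
  letI lm : Module R (M.Tens N) :=
    { smul := fun r z => M.tensL N r z
      one_smul := fun z => LinearMap.congr_fun (tensL_one M N) z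
      mul_smul := fun a b z => LinearMap.congr_fun (tensL_mul M N a b) z
      smul_zero := fun a => map_zero (M.tensL N a)
      smul_add := fun a => map_add (M.tensL N a)
      add_smul := fun a b z => LinearMap.congr_fun (map_add (M.tensL N) a b) z
      zero_smul := fun z => LinearMap.congr_fun (map_zero (M.tensL N)) z }
  letI rm : Module Rᵐᵒᵖ (M.Tens N) :=
    { smul := fun r z => M.tensR N r.unop z
      one_smul := fun z => LinearMap.congr_fun (tensR_one M N) z
      mul_smul := fun a b z => LinearMap.congr_fun (tensR_mul M N b.unop a.unop) z
      smul_zero := fun a => map_zero (M.tensR N a.unop)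
      smul_add := fun a => map_add (M.tensR N a.unop)
      add_smul := fun a b z => LinearMap.congr_fun (map_add (M.tensR N) a.unop b.unop) z
      zero_smul := fun z => LinearMap.congr_fun (map_zero (M.tensR N)) z }
  { carrier := M.Tens N
    leftModule := lm
    rightModule := rm
    smulComm := ⟨fun a b z => LinearMap.congr_fun (tensL_tensR M N a b.unop) z⟩
    leftTower := ⟨fun c a z => LinearMap.congr_fun (map_smul (M.tensL N) c a) z⟩
    rightTower := ⟨fun c a z => LinearMap.congr_fun (map_smul (M.tensR N) c a.unop) z⟩ }

/-! #### The dual `M^* = Hom_R(M, R)` of right `R`-linear maps -/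

/-- The right `R`-linear maps `M → R`. -/
abbrev Dual (M : RBimod k R) : Type w := M →ₗ[Rᵐᵒᵖ] R

theorem dual_smul (M : RBimod k R) (φ : M.Dual) (c : k) (m : M) : φ (c • m) = c • φ m := by
  rw [← algebraMap_smul Rᵐᵒᵖ c m, map_smul, algebraMap_smul]

/-- The left action `(r φ)(m) = r φ(m)` on the dual. -/
def dualL (M : RBimod k R) : R →ₗ[k] Module.End k M.Dual :=
  LinearMap.mk₂ k
    (fun r φ =>
      { toFun := fun m => r * φ m
        map_add' := fun x y => by rw [map_add, mul_add]
        map_smul' := fun a x => by simp [mul_assoc] })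
    (fun a b φ => by ext x; simp [add_mul])
    (fun c a φ => by ext x; simp)
    (fun a φ ψ => by ext x; simp [mul_add])
    (fun c a φ => by ext x; simp)

/-- The right action `(φ r)(m) = φ(r m)` on the dual. -/
def dualR (M : RBimod k R) : R →ₗ[k] Module.End k M.Dual :=
  LinearMap.mk₂ k
    (fun r φ =>
      { toFun := fun m => φ (r • m)
        map_add' := fun x y => by rw [smul_add, map_add]
        map_smul' := fun a x => by
          rw [smul_comm, map_smul, RingHom.id_apply] })
    (fun a b φ => by ext x; simp [add_smul])
    (fun c a φ => by
      ext x
      change φ ((c • a) • x) = c • φ (a • x)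
      rw [smul_assoc, M.dual_smul])
    (fun a φ ψ => by ext x; simp)
    (fun c a φ => by ext x; simp)

@[simp] theorem dualL_apply (M : RBimod k R) (r : R) (φ : M.Dual) (m : M) :
    M.dualL r φ m = r * φ m := rfl
@[simp] theorem dualR_apply (M : RBimod k R) (r : R) (φ : M.Dual) (m : M) :
    M.dualR r φ m = φ (r • m) := rfl

/-- The transpose `φ ↦ φ ∘ f` of a bimodule map. -/
def Hom.dual {M N : RBimod k R} (f : Hom M N) : N.Dual →ₗ[k] M.Dual where
  toFun φ :=
    { toFun := fun m => φ (f.lin m)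
      map_add' := fun x y => by rw [map_add, map_add]
      map_smul' := fun a x => by
        rw [RingHom.id_apply, ← op_unop a, f.map_right, map_smul] }
  map_add' _ _ := rfl
  map_smul' _ _ := rfl

@[simp] theorem Hom.dual_apply {M N : RBimod k R} (f : Hom M N) (φ : N.Dual) (m : M) :
    f.dual φ m = φ (f.lin m) := rfl

/-- `m_i`, `φ^i` are dual bases of the right module `M`: `m = ∑ m_i φ^i(m)` for all `m`. -/
def IsDualBasis (M : RBimod k R) {n : ℕ} (e : Fin n → M) (e' : Fin n → M.Dual) : Prop :=
  ∀ m : M, m = ∑ i, op (e' i m) • e i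

/-- Left rigid bimodules: finitely generated projective as right `R`-modules. -/
def IsLeftRigid (M : RBimod k R) : Prop :=
  Module.Finite Rᵐᵒᵖ M ∧ Module.Projective Rᵐᵒᵖ M

/-- For `φ ∈ M^*` and `ψ ∈ N^*` the element of `(M ⊗_R N)^*` given by
`m ⊗ n ↦ ψ(φ(m) n)`; this is the identification `N^* ⊗_R M^* ≅ (M ⊗_R N)^*`. -/
def dualTens {M N : RBimod k R} (φ : M.Dual) (ψ : N.Dual) : (M.tensor N).Dual :=
  letI T : M.Tens N →ₗ[k] R := Bal.lift
    (TensorProduct.lift (LinearMap.mk₂ k (fun m n => ψ (φ m • n))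
      (fun _ _ _ => by rw [map_add, add_smul, map_add])
      (fun c m n => by rw [M.dual_smul φ, smul_assoc, N.dual_smul ψ])
      (fun _ _ _ => by rw [smul_add, map_add])
      (fun c m n => by
        rw [← N.dual_smul ψ, ← N.lact_apply, map_smul, N.lact_apply])))
    (fun r m n => by simp [mul_smul])
  { toFun := T
    map_add' := fun x y => map_add T x y
    map_smul' := fun a x => by
      have h : T ∘ₗ M.tensR N a.unop = LinearMap.mulRight k a.unop ∘ₗ T :=
        Bal.hom_ext fun m n => by
          rw [LinearMap.comp_apply, LinearMap.comp_apply, tensR_tmul]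
          change ψ (φ m • (a • n)) = ψ (φ m • n) * a.unop
          rw [smul_comm, map_smul]
          rfl
      exact LinearMap.congr_fun h x }

@[simp] theorem dualTens_tmul {M N : RBimod k R} (φ : M.Dual) (ψ : N.Dual) (m : M) (n : N) :
    dualTens φ ψ (tmul m n : M.Tens N) = ψ (φ m • n) := rfl

end RBimod

end Bimodules
/-! ### Double `R`-bimodules -/

/-- Two commuting (`k`-central) `R`-bimodule structures `σ`, `τ` on a `k`-module `L`:
`sl a h = σ(a)h`, `sr a h = hσ(a)`, `tl a h = τ(a)h`, `tr a h = hτ(a)`. -/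
structure DoubleBimod (k : Type u) (R : Type w) [CommRing k] [Ring R] [Algebra k R]
    (L : Type v) [AddCommGroup L] [Module k L] where
  /-- `h ↦ σ(a)h` -/
  sl : R →ₗ[k] Module.End k L
  /-- `h ↦ hσ(a)` -/
  sr : R →ₗ[k] Module.End k L
  /-- `h ↦ τ(a)h` -/
  tl : R →ₗ[k] Module.End k L
  /-- `h ↦ hτ(a)` -/
  tr : R →ₗ[k] Module.End k L
  sl_one : ∀ h, sl 1 h = h
  sr_one : ∀ h, sr 1 h = h
  tl_one : ∀ h, tl 1 h = h
  tr_one : ∀ h, tr 1 h = h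
  sl_mul : ∀ a b h, sl (a * b) h = sl a (sl b h)
  sr_mul : ∀ a b h, sr (a * b) h = sr b (sr a h)
  tl_mul : ∀ a b h, tl (a * b) h = tl a (tl b h)
  tr_mul : ∀ a b h, tr (a * b) h = tr b (tr a h)
  sl_sr : ∀ a b h, sl a (sr b h) = sr b (sl a h)
  sl_tl : ∀ a b h, sl a (tl b h) = tl b (sl a h)
  sl_tr : ∀ a b h, sl a (tr b h) = tr b (sl a h)
  sr_tl : ∀ a b h, sr a (tl b h) = tl b (sr a h)
  sr_tr : ∀ a b h, sr a (tr b h) = tr b (sr a h)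
  tl_tr : ∀ a b h, tl a (tr b h) = tr b (tl a h)

section Double

variable {k : Type u} {R : Type w} [CommRing k] [Ring R] [Algebra k R]
  {L : Type w₁} [AddCommGroup L] [Module k L] {K : Type w₂} [AddCommGroup K] [Module k K]
  {P : Type w₃} [AddCommGroup P] [Module k P]

namespace DoubleBimod

/-- `φ` commutes with all four actions. -/
structure IsHom (D : DoubleBimod k R L) (E : DoubleBimod k R K) (φ : L →ₗ[k] K) : Prop where
  map_sl : ∀ a h, φ (D.sl a h) = E.sl a (φ h)
  map_sr : ∀ a h, φ (D.sr a h) = E.sr a (φ h)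
  map_tl : ∀ a h, φ (D.tl a h) = E.tl a (φ h)
  map_tr : ∀ a h, φ (D.tr a h) = E.tr a (φ h)

/-- `L ⊗ K` modulo `hτ(a) ⊗ k = h ⊗ σ(a)k`. -/
abbrev TS (D : DoubleBimod k R L) (E : DoubleBimod k R K) : Type (max w₁ w₂) :=
  Bal (fun a => D.tr a) (fun a => E.sl a)

/-- `L ⊗ K` modulo `σ(a)h ⊗ k = h ⊗ kσ(a)`. -/
abbrev SS (D : DoubleBimod k R L) (E : DoubleBimod k R K) : Type (max w₁ w₂) :=
  Bal (fun a => D.sl a) (fun a => E.sr a)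

/-- `L ⊗ K` modulo `hτ(a) ⊗ k = h ⊗ τ(a)k`. -/
abbrev TT (D : DoubleBimod k R L) (E : DoubleBimod k R K) : Type (max w₁ w₂) :=
  Bal (fun a => D.tr a) (fun a => E.tl a)

/-- `L ⊠ K`, i.e. `L ⊗ K` modulo `σ(a)hτ(b) ⊗ k = h ⊗ τ(b)kσ(a)`. -/
abbrev Box (D : DoubleBimod k R L) (E : DoubleBimod k R K) : Type (max w₁ w₂) :=
  Bal (fun p : R × R => D.sl p.1 ∘ₗ D.tr p.2) (fun p => E.tl p.2 ∘ₗ E.sr p.1)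

/-- The quotient map to `L τ⊗σ K`. -/
abbrev mkTS (D : DoubleBimod k R L) (E : DoubleBimod k R K) : L ⊗[k] K →ₗ[k] TS D E :=
  Bal.mk _ _

/-- The quotient map to `L σ⊗σ K`. -/
abbrev mkSS (D : DoubleBimod k R L) (E : DoubleBimod k R K) : L ⊗[k] K →ₗ[k] SS D E :=
  Bal.mk _ _

/-- The quotient map to `L τ⊗τ K`. -/
abbrev mkTT (D : DoubleBimod k R L) (E : DoubleBimod k R K) : L ⊗[k] K →ₗ[k] TT D E :=
  Bal.mk _ _

/-- The quotient map to `L ⊠ K`. -/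
abbrev mkBox (D : DoubleBimod k R L) (E : DoubleBimod k R K) : L ⊗[k] K →ₗ[k] Box D E :=
  Bal.mk _ _

/-- The double bimodule structure on `L τ⊗σ K`:
`σ(a)(h ⊗ k)σ(b) = σ(a)hσ(b) ⊗ k` and `τ(a)(h ⊗ k)τ(b) = h ⊗ τ(a)kτ(b)`. -/
def ts (D : DoubleBimod k R L) (E : DoubleBimod k R K) : DoubleBimod k R (TS D E) where
  sl := Bal.actL D.sl (fun a b h => D.sl_tr a b h)
  sr := Bal.actL D.sr (fun a b h => D.sr_tr a b h)
  tl := Bal.actR E.tl (fun a b h => (E.sl_tl b a h).symm)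
  tr := Bal.actR E.tr (fun a b h => (E.sl_tr b a h).symm)
  sl_one z := by
    induction z using Bal.ind with
    | tmul m n => simp [D.sl_one]
    | add x y hx hy => simp only [map_add, hx, hy]
  sr_one z := by
    induction z using Bal.ind with
    | tmul m n => simp [D.sr_one]
    | add x y hx hy => simp only [map_add, hx, hy]
  tl_one z := by
    induction z using Bal.ind with
    | tmul m n => simp [E.tl_one]
    | add x y hx hy => simp only [map_add, hx, hy]
  tr_one z := by
    induction z using Bal.ind with
    | tmul m n => simp [E.tr_one]
    | add x y hx hy => simp only [map_add, hx, hy]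
  sl_mul a b z := by
    induction z using Bal.ind with
    | tmul m n => simp [D.sl_mul]
    | add x y hx hy => simp only [map_add, hx, hy]
  sr_mul a b z := by
    induction z using Bal.ind with
    | tmul m n => simp [D.sr_mul]
    | add x y hx hy => simp only [map_add, hx, hy]
  tl_mul a b z := by
    induction z using Bal.ind with
    | tmul m n => simp [E.tl_mul]
    | add x y hx hy => simp only [map_add, hx, hy]
  tr_mul a b z := by
    induction z using Bal.ind with
    | tmul m n => simp [E.tr_mul]
    | add x y hx hy => simp only [map_add, hx, hy]
  sl_sr a b z := by
    induction z using Bal.ind with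
    | tmul m n => simp [D.sl_sr]
    | add x y hx hy => simp only [map_add, hx, hy]
  sl_tl a b z := by
    induction z using Bal.ind with
    | tmul m n => simp
    | add x y hx hy => simp only [map_add, hx, hy]
  sl_tr a b z := by
    induction z using Bal.ind with
    | tmul m n => simp
    | add x y hx hy => simp only [map_add, hx, hy]
  sr_tl a b z := by
    induction z using Bal.ind with
    | tmul m n => simp
    | add x y hx hy => simp only [map_add, hx, hy]
  sr_tr a b z := by
    induction z using Bal.ind with
    | tmul m n => simp
    | add x y hx hy => simp only [map_add, hx, hy]
  tl_tr a b z := by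
    induction z using Bal.ind with
    | tmul m n => simp [E.tl_tr]
    | add x y hx hy => simp only [map_add, hx, hy]

/-- The double bimodule structure on `L ⊠ K`:
`σ(a)(h ⊠ k)σ(b) = hσ(b) ⊠ σ(a)k` and `τ(a)(h ⊠ k)τ(b) = τ(a)h ⊠ kτ(b)`. -/
def box (D : DoubleBimod k R L) (E : DoubleBimod k R K) : DoubleBimod k R (Box D E) where
  sl := Bal.actR E.sl (fun a b h => by simp [E.sl_sr, E.sl_tl])
  sr := Bal.actL D.sr (fun a b h => by simp [← D.sl_sr, D.sr_tr])
  tl := Bal.actL D.tl (fun a b h => by simp [← D.sl_tl, D.tl_tr])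
  tr := Bal.actR E.tr (fun a b h => by simp [E.sr_tr, E.tl_tr])
  sl_one z := by
    induction z using Bal.ind with
    | tmul m n => simp [E.sl_one]
    | add x y hx hy => simp only [map_add, hx, hy]
  sr_one z := by
    induction z using Bal.ind with
    | tmul m n => simp [D.sr_one]
    | add x y hx hy => simp only [map_add, hx, hy]
  tl_one z := by
    induction z using Bal.ind with
    | tmul m n => simp [D.tl_one]
    | add x y hx hy => simp only [map_add, hx, hy]
  tr_one z := by
    induction z using Bal.ind with
    | tmul m n => simp [E.tr_one]
    | add x y hx hy => simp only [map_add, hx, hy]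
  sl_mul a b z := by
    induction z using Bal.ind with
    | tmul m n => simp [E.sl_mul]
    | add x y hx hy => simp only [map_add, hx, hy]
  sr_mul a b z := by
    induction z using Bal.ind with
    | tmul m n => simp [D.sr_mul]
    | add x y hx hy => simp only [map_add, hx, hy]
  tl_mul a b z := by
    induction z using Bal.ind with
    | tmul m n => simp [D.tl_mul]
    | add x y hx hy => simp only [map_add, hx, hy]
  tr_mul a b z := by
    induction z using Bal.ind with
    | tmul m n => simp [E.tr_mul]
    | add x y hx hy => simp only [map_add, hx, hy]
  sl_sr a b z := by
    induction z using Bal.ind with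
    | tmul m n => simp
    | add x y hx hy => simp only [map_add, hx, hy]
  sl_tl a b z := by
    induction z using Bal.ind with
    | tmul m n => simp
    | add x y hx hy => simp only [map_add, hx, hy]
  sl_tr a b z := by
    induction z using Bal.ind with
    | tmul m n => simp [E.sl_tr]
    | add x y hx hy => simp only [map_add, hx, hy]
  sr_tl a b z := by
    induction z using Bal.ind with
    | tmul m n => simp [D.sr_tl]
    | add x y hx hy => simp only [map_add, hx, hy]
  sr_tr a b z := by
    induction z using Bal.ind with
    | tmul m n => simp
    | add x y hx hy => simp only [map_add, hx, hy]
  tl_tr a b z := by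
    induction z using Bal.ind with
    | tmul m n => simp
    | add x y hx hy => simp only [map_add, hx, hy]

/-- The double bimodule structure on `R ⊗ₖ R`:
`σ(a)τ(b)(m ⊗ n)σ(c)τ(d) = amc ⊗ bnd`. -/
def unit (k : Type u) (R : Type w) [CommRing k] [Ring R] [Algebra k R] :
    DoubleBimod k R (R ⊗[k] R) where
  sl := LinearMap.rTensorHom R ∘ₗ LinearMap.mul k R
  sr := LinearMap.rTensorHom R ∘ₗ (LinearMap.mul k R).flip
  tl := LinearMap.lTensorHom R ∘ₗ LinearMap.mul k R
  tr := LinearMap.lTensorHom R ∘ₗ (LinearMap.mul k R).flip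
  sl_one z := by
    induction z using TensorProduct.induction_on with
    | zero => simp only [map_zero]
    | tmul m n => simp
    | add x y hx hy => simp only [map_add, hx, hy]
  sr_one z := by
    induction z using TensorProduct.induction_on with
    | zero => simp only [map_zero]
    | tmul m n => simp
    | add x y hx hy => simp only [map_add, hx, hy]
  tl_one z := by
    induction z using TensorProduct.induction_on with
    | zero => simp only [map_zero]
    | tmul m n => simp
    | add x y hx hy => simp only [map_add, hx, hy]
  tr_one z := by
    induction z using TensorProduct.induction_on with
    | zero => simp only [map_zero]
    | tmul m n => simp
    | add x y hx hy => simp only [map_add, hx, hy]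
  sl_mul a b z := by
    induction z using TensorProduct.induction_on with
    | zero => simp only [map_zero]
    | tmul m n => simp [mul_assoc]
    | add x y hx hy => simp only [map_add, hx, hy]
  sr_mul a b z := by
    induction z using TensorProduct.induction_on with
    | zero => simp only [map_zero]
    | tmul m n => simp [mul_assoc]
    | add x y hx hy => simp only [map_add, hx, hy]
  tl_mul a b z := by
    induction z using TensorProduct.induction_on with
    | zero => simp only [map_zero]
    | tmul m n => simp [mul_assoc]
    | add x y hx hy => simp only [map_add, hx, hy]
  tr_mul a b z := by
    induction z using TensorProduct.induction_on with
    | zero => simp only [map_zero]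
    | tmul m n => simp [mul_assoc]
    | add x y hx hy => simp only [map_add, hx, hy]
  sl_sr a b z := by
    induction z using TensorProduct.induction_on with
    | zero => simp only [map_zero]
    | tmul m n => simp [mul_assoc]
    | add x y hx hy => simp only [map_add, hx, hy]
  sl_tl a b z := by
    induction z using TensorProduct.induction_on with
    | zero => simp only [map_zero]
    | tmul m n => simp
    | add x y hx hy => simp only [map_add, hx, hy]
  sl_tr a b z := by
    induction z using TensorProduct.induction_on with
    | zero => simp only [map_zero]
    | tmul m n => simp
    | add x y hx hy => simp only [map_add, hx, hy]
  sr_tl a b z := by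
    induction z using TensorProduct.induction_on with
    | zero => simp only [map_zero]
    | tmul m n => simp
    | add x y hx hy => simp only [map_add, hx, hy]
  sr_tr a b z := by
    induction z using TensorProduct.induction_on with
    | zero => simp only [map_zero]
    | tmul m n => simp
    | add x y hx hy => simp only [map_add, hx, hy]
  tl_tr a b z := by
    induction z using TensorProduct.induction_on with
    | zero => simp only [map_zero]
    | tmul m n => simp [mul_assoc]
    | add x y hx hy => simp only [map_add, hx, hy]

/-- The associativity map `(L τ⊗σ K) τ⊗σ P → L τ⊗σ (K τ⊗σ P)`,
`(x ⊗ y) ⊗ z ↦ x ⊗ (y ⊗ z)`. -/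
def assocTS (D : DoubleBimod k R L) (E : DoubleBimod k R K) (G : DoubleBimod k R P) :
    TS (D.ts E) G →ₗ[k] TS D (E.ts G) :=
  Bal.lift
    (TensorProduct.lift (Bal.lift
      (TensorProduct.curry (mkTS D (E.ts G) ∘ₗ LinearMap.lTensor L (mkTS E G) ∘ₗ
        (TensorProduct.assoc k L K P).toLinearMap))
      (fun a m n => by
        ext p
        exact Bal.tmul_bal (f := fun a => D.tr a) (g := fun a => (E.ts G).sl a) a m
          (Bal.tmul _ _ n p))))
    (fun a z p => by
      induction z using Bal.ind with
      | tmul x y =>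
        exact congrArg (Bal.tmul (fun a => D.tr a) (fun a => (E.ts G).sl a) x)
          (Bal.tmul_bal (f := fun a => E.tr a) (g := fun a => G.sl a) a y p)
      | add x y hx hy => simp only [map_add, TensorProduct.add_tmul, hx, hy])

@[simp] theorem assocTS_tmul (D : DoubleBimod k R L) (E : DoubleBimod k R K)
    (G : DoubleBimod k R P) (x : L) (y : K) (z : P) :
    assocTS D E G (Bal.tmul _ _ (Bal.tmul _ _ x y) z) =
      Bal.tmul _ _ x (Bal.tmul _ _ y z) := rfl

end DoubleBimod

/-! ### Coalgebroids, bialgebroids, antipodes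

Formulas in Sweedler notation are stated for every element `Z = ∑ x ⊗ y` of `L ⊗ₖ L` which
represents the value of the coproduct (or antipode) in the relevant quotient of `L ⊗ₖ L`; thus
the equations include that the expressions do not depend on the representative. -/

open DoubleBimod

/-- A coalgebroid structure on the double bimodule `D`. -/
structure Coalgebroid (D : DoubleBimod k R L) where
  /-- the coproduct `Δ : L → L τ⊗σ L` -/
  Δ : L →ₗ[k] TS D D
  /-- the counit -/
  ε : L →ₗ[k] R
  Δ_hom : D.IsHom (D.ts D) Δ
  /-- `(id ⊗ Δ)Δ = (Δ ⊗ id)Δ` -/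
  coassoc : ∀ (h : L) (Z : L ⊗[k] L), mkTS D D Z = Δ h →
    assocTS D D D (mkTS (D.ts D) D (LinearMap.rTensor L Δ Z)) =
      mkTS D (D.ts D) (LinearMap.lTensor L Δ Z)
  /-- `ε(σ(a)hτ(b)) = a ε(h) b` -/
  ε_lin : ∀ a b h, ε (D.sl a (D.tr b h)) = a * ε h * b
  /-- `∑ σ(ε(h₁))h₂ = h` -/
  counit_left : ∀ (h : L) (Z : L ⊗[k] L), mkTS D D Z = Δ h →
    TensorProduct.lift (D.sl ∘ₗ ε) Z = h
  /-- `∑ h₁τ(ε(h₂)) = h` -/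
  counit_right : ∀ (h : L) (Z : L ⊗[k] L), mkTS D D Z = Δ h →
    TensorProduct.lift (D.tr ∘ₗ ε).flip Z = h
  /-- `ε(τ(a)h) = ε(hσ(a))` -/
  ε_tl : ∀ a h, ε (D.tl a h) = ε (D.sr a h)

/-- A bialgebroid structure on the double bimodule `D`: a monoid in the monoidal category of
coalgebroids, with tensor product `⊠` and unit object `R ⊗ₖ R`. -/
structure Bialgebroid (D : DoubleBimod k R L) extends Coalgebroid D where
  /-- the product -/
  m : Box D D →ₗ[k] L
  /-- the unit -/
  u : R ⊗[k] R →ₗ[k] L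
  m_hom : (D.box D).IsHom D m
  u_hom : (DoubleBimod.unit k R).IsHom D u
  /-- `Δ(h ∘ g) = ∑ h₁ ∘ g₁ ⊗ h₂ ∘ g₂` -/
  Δ_m : ∀ (h g : L) (H G : L ⊗[k] L), mkTS D D H = Δ h → mkTS D D G = Δ g →
    Δ (m (mkBox D D (h ⊗ₜ[k] g))) = mkTS D D
      (TensorProduct.map (m ∘ₗ mkBox D D) (m ∘ₗ mkBox D D)
        (TensorProduct.tensorTensorTensorComm k L L L L (H ⊗ₜ[k] G)))
  /-- `ε(h ∘ g) = ε(gσ(ε(h)))` -/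
  ε_m : ∀ h g, ε (m (mkBox D D (h ⊗ₜ[k] g))) = ε (D.sr (ε h) g)
  /-- `Δ u = (u ⊗ u) Δ`, where `Δ(a ⊗ b) = (a ⊗ 1) ⊗ (1 ⊗ b)` in `R ⊗ₖ R` -/
  Δ_u : ∀ a b, Δ (u (a ⊗ₜ[k] b)) = mkTS D D (u (a ⊗ₜ[k] 1) ⊗ₜ[k] u (1 ⊗ₜ[k] b))
  ε_u : ∀ a b, ε (u (a ⊗ₜ[k] b)) = a * b
  m_assoc : ∀ x y z, m (mkBox D D (m (mkBox D D (x ⊗ₜ[k] y)) ⊗ₜ[k] z)) =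
    m (mkBox D D (x ⊗ₜ[k] m (mkBox D D (y ⊗ₜ[k] z))))
  /-- unitality with respect to `h ⊠ (a ⊗ b) ↔ σ(a)hτ(b)` -/
  m_u : ∀ h a b, m (mkBox D D (h ⊗ₜ[k] u (a ⊗ₜ[k] b))) = D.sl a (D.tr b h)
  /-- unitality with respect to `(a ⊗ b) ⊠ h ↔ τ(b)hσ(a)` -/
  u_m : ∀ h a b, m (mkBox D D (u (a ⊗ₜ[k] b) ⊗ₜ[k] h)) = D.tl b (D.sr a h)

namespace Bialgebroid

variable {D : DoubleBimod k R L} (B : Bialgebroid D)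

/-- The product `h ∘ g`. -/
def mul : L →ₗ[k] L →ₗ[k] L := TensorProduct.curry (B.m ∘ₗ mkBox D D)

/-- `1_L = u(1 ⊗ 1)`. -/
def one : L := B.u (1 ⊗ₜ[k] 1)

theorem mul_tr (h : L) (a : R) (g : L) : B.mul h (D.tr a g) = D.tr a (B.mul h g) :=
  B.m_hom.map_tr a (mkBox D D (h ⊗ₜ[k] g))

theorem mul_sl (h : L) (a : R) (g : L) : B.mul h (D.sl a g) = D.sl a (B.mul h g) :=
  B.m_hom.map_sl a (mkBox D D (h ⊗ₜ[k] g))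

/-- `x, y ⊗ z ↦ x ∘ y ⊗ z` on `L τ⊗σ L`. -/
def mulTSl : L →ₗ[k] TS D D →ₗ[k] TS D D := Bal.actL B.mul (fun x a y => B.mul_tr x a y)

/-- `x, y ⊗ z ↦ y ⊗ x ∘ z` on `L τ⊗σ L`. -/
def mulTSr : L →ₗ[k] TS D D →ₗ[k] TS D D := Bal.actR B.mul (fun x a y => B.mul_sl x a y)

/-- `x, y ⊗ z ↦ x ∘ y ⊗ z` on `L σ⊗σ L`. -/
def mulSS : L →ₗ[k] SS D D →ₗ[k] SS D D := Bal.actL B.mul (fun x a y => B.mul_sl x a y)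

/-- `x, y ⊗ z ↦ x ∘ y ⊗ z` on `L τ⊗τ L`. -/
def mulTT : L →ₗ[k] TT D D →ₗ[k] TT D D := Bal.actL B.mul (fun x a y => B.mul_tr x a y)

/-- An antipode `∇ : L → L σ⊗σ L`, `∇(h) = ∑ h⁻ ⊗ h⁺`. A bialgebroid which admits an antipode is
a Hopf algebroid. -/
structure Antipode where
  /-- the map `∇` -/
  nabla : L →ₗ[k] SS D D
  /-- `∑ h⁻ ∘ (h⁺)₁ ⊗ (h⁺)₂ = 1 ⊗ h` in `L τ⊗σ L` -/
  nabla_Δ : ∀ (h : L) (Z : L ⊗[k] L), mkSS D D Z = nabla h →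
    TensorProduct.lift (B.mulTSl.compl₂ B.Δ) Z = mkTS D D (B.one ⊗ₜ[k] h)
  /-- `∑ h₁ ∘ (h₂)⁻ ⊗ (h₂)⁺ = 1 ⊗ h` in `L σ⊗σ L` -/
  Δ_nabla : ∀ (h : L) (Z : L ⊗[k] L), mkTS D D Z = B.Δ h →
    TensorProduct.lift (B.mulSS.compl₂ nabla) Z = mkSS D D (B.one ⊗ₜ[k] h)

/-- An opposite antipode `∇ᵒᵖ : L → L τ⊗τ L`, `∇ᵒᵖ(h) = ∑ h₋ ⊗ h₊`. A bialgebroid equipped with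
an opposite antipode is an opposite Hopf algebroid. -/
structure OppAntipode where
  /-- the map `∇ᵒᵖ` -/
  nabla : L →ₗ[k] TT D D
  /-- `∑ (h₊)₁ ⊗ h₋ ∘ (h₊)₂ = h ⊗ 1` in `L τ⊗σ L` -/
  nabla_Δ : ∀ (h : L) (Z : L ⊗[k] L), mkTT D D Z = nabla h →
    TensorProduct.lift (B.mulTSr.compl₂ B.Δ) Z = mkTS D D (h ⊗ₜ[k] B.one)
  /-- `∑ h₂ ∘ (h₁)₋ ⊗ (h₁)₊ = 1 ⊗ h` in `L τ⊗τ L` -/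
  Δ_nabla : ∀ (h : L) (Z : L ⊗[k] L), mkTS D D Z = B.Δ h →
    TensorProduct.lift (B.mulTT.compl₂ nabla).flip Z = mkTT D D (B.one ⊗ₜ[k] h)

end Bialgebroid

end Double

/-! ### The coend of a functor to bimodules -/

section CoendSection

variable {k : Type u} {R : Type w} [CommRing k] [Ring R] [Algebra k R]
  {C : Type w₁} [Category.{w₂} C]

/-- The linear map underlying a morphism of bimodules. -/
def RBimod.toLin {M N : RBimod k R} (f : M ⟶ N) : M →ₗ[k] N := RBimod.Hom.lin f

/-- The transpose `N^* → M^*` of a morphism `M ⟶ N` of bimodules. -/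
def RBimod.transpose {M N : RBimod k R} (f : M ⟶ N) : N.Dual →ₗ[k] M.Dual := RBimod.Hom.dual f

@[simp] theorem RBimod.transpose_apply {M N : RBimod k R} (f : M ⟶ N) (φ : N.Dual) (m : M) :
    RBimod.transpose f φ m = φ (RBimod.toLin f m) := rfl

variable (F : C ⥤ RBimod k R)

/-- `F(X)^* ⊗ₖ F(X)`. -/
def CoendSummand (X : C) : Type w := (F.obj X).Dual ⊗[k] (F.obj X)

instance (X : C) : AddCommGroup (CoendSummand F X) :=
  inferInstanceAs (AddCommGroup ((F.obj X).Dual ⊗[k] (F.obj X)))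

instance (X : C) : Module k (CoendSummand F X) :=
  inferInstanceAs (Module k ((F.obj X).Dual ⊗[k] (F.obj X)))

/-- `L₀ = ⨁_X F(X)^* ⊗ₖ F(X)`. -/
abbrev CoendSum : Type (max w₁ w) := DirectSum C fun X => CoendSummand F X

/-- The inclusion of the summand at `X`. -/
noncomputable def coendSumOf (X : C) : (F.obj X).Dual ⊗[k] (F.obj X) →ₗ[k] CoendSum F :=
  letI := Classical.decEq C
  DirectSum.lof k C (fun X => CoendSummand F X) X

/-- The relations `F(f)^*φ ⊗ m = φ ⊗ F(f)m` for `f : X ⟶ Y`, `φ ∈ F(Y)^*`, `m ∈ F(X)`. -/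
noncomputable def coendRel : Submodule k (CoendSum F) :=
  Submodule.span k {z | ∃ (X Y : C) (f : X ⟶ Y) (φ : (F.obj Y).Dual) (m : F.obj X),
    z = coendSumOf F X (RBimod.transpose (F.map f) φ ⊗ₜ[k] m) -
      coendSumOf F Y (φ ⊗ₜ[k] RBimod.toLin (F.map f) m)}

/-- The coend `L` of `F`: the quotient of `⨁_X F(X)^* ⊗ₖ F(X)` by the relations
`F(f)^*φ ⊗ m = φ ⊗ F(f)m`. -/
abbrev Coend : Type (max w₁ w) := CoendSum F ⧸ coendRel F

namespace Coend

/-- The map `F(X)^* ⊗ₖ F(X) → L`. -/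
noncomputable def of (X : C) : (F.obj X).Dual ⊗[k] (F.obj X) →ₗ[k] Coend F :=
  (coendRel F).mkQ ∘ₗ coendSumOf F X

/-- The class in `L` of `φ ⊗ m`, for `φ ∈ F(X)^*` and `m ∈ F(X)`. -/
noncomputable def cls (X : C) (φ : (F.obj X).Dual) (m : F.obj X) : Coend F :=
  of F X (φ ⊗ₜ[k] m)

variable {F}

theorem cls_rel {X Y : C} (f : X ⟶ Y) (φ : (F.obj Y).Dual) (m : F.obj X) :
    cls F X (RBimod.transpose (F.map f) φ) m = cls F Y φ (RBimod.toLin (F.map f) m) :=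
  (Submodule.Quotient.eq _).2 (Submodule.subset_span ⟨X, Y, f, φ, m, rfl⟩)

theorem ind {p : Coend F → Prop} (zero : p 0) (cls : ∀ X φ m, p (cls F X φ m))
    (add : ∀ x y, p x → p y → p (x + y)) (z : Coend F) : p z := by
  classical
  obtain ⟨z, rfl⟩ := Submodule.mkQ_surjective _ z
  induction z using DirectSum.induction_on with
  | zero => rwa [map_zero]
  | add x y hx hy => rw [map_add]; exact add _ _ hx hy
  | of X t =>
    have key (t : (F.obj X).Dual ⊗[k] (F.obj X)) : p (of F X t) := by
      induction t using TensorProduct.induction_on with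
      | zero => rwa [map_zero]
      | add x y hx hy => rw [map_add]; exact add _ _ hx hy
      | tmul φ m => exact cls X φ m
    convert key t
    simp only [of, coendSumOf]
    congr!

theorem hom_ext {A : Type w₃} [AddCommGroup A] [Module k A] {φ ψ : Coend F →ₗ[k] A}
    (h : ∀ X x m, φ (cls F X x m) = ψ (cls F X x m)) : φ = ψ := by
  refine LinearMap.ext fun z => ?_
  induction z using ind with
  | zero => simp only [map_zero]
  | cls X x m => exact h X x m
  | add x y hx hy => rw [map_add, map_add, hx, hy]

/-- Linear maps on the summands which respect the relations descend to `L`. -/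
noncomputable def lift {A : Type w₃} [AddCommGroup A] [Module k A]
    (δ : ∀ X, (F.obj X).Dual ⊗[k] (F.obj X) →ₗ[k] A)
    (h : ∀ (X Y : C) (f : X ⟶ Y) (φ : (F.obj Y).Dual) (m : F.obj X),
      δ X (RBimod.transpose (F.map f) φ ⊗ₜ[k] m) = δ Y (φ ⊗ₜ[k] RBimod.toLin (F.map f) m)) :
    Coend F →ₗ[k] A :=
  letI := Classical.decEq C
  letI T : CoendSum F →ₗ[k] A := DirectSum.toModule k C A (M := fun X => CoendSummand F X) δ
  (coendRel F).liftQ T (by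
    refine Submodule.span_le.2 ?_
    rintro _ ⟨X, Y, f, φ, m, rfl⟩
    have hT (X : C) (z : (F.obj X).Dual ⊗[k] (F.obj X)) : T (coendSumOf F X z) = δ X z :=
      DirectSum.toModule_lof (M := fun X => CoendSummand F X) k X z
    simp only [SetLike.mem_coe, LinearMap.mem_ker, map_sub, hT, h, sub_self])

@[simp] theorem lift_cls {A : Type w₃} [AddCommGroup A] [Module k A]
    (δ : ∀ X, (F.obj X).Dual ⊗[k] (F.obj X) →ₗ[k] A)
    (h : ∀ (X Y : C) (f : X ⟶ Y) (φ : (F.obj Y).Dual) (m : F.obj X),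
      δ X (RBimod.transpose (F.map f) φ ⊗ₜ[k] m) = δ Y (φ ⊗ₜ[k] RBimod.toLin (F.map f) m))
    (X : C) (φ : (F.obj X).Dual) (m : F.obj X) :
    lift δ h (cls F X φ m) = δ X (φ ⊗ₜ[k] m) :=
  letI := Classical.decEq C
  DirectSum.toModule_lof (M := fun X => CoendSummand F X) k X (φ ⊗ₜ[k] m)

/-- Operators `d X r` on the `F(X)^*`, which are natural in `X`, act on `L` by
`φ ⊗ m ↦ d X r φ ⊗ m`. -/
noncomputable def actDual (d : ∀ X, R →ₗ[k] Module.End k (F.obj X).Dual)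
    (h : ∀ (r : R) (X Y : C) (f : X ⟶ Y) (φ : (F.obj Y).Dual),
      d X r (RBimod.transpose (F.map f) φ) = RBimod.transpose (F.map f) (d Y r φ)) :
    R →ₗ[k] Module.End k (Coend F) where
  toFun r := lift (fun X => of F X ∘ₗ LinearMap.rTensor (F.obj X) (d X r))
    (fun X Y f φ m => by
      rw [LinearMap.comp_apply, LinearMap.comp_apply, LinearMap.rTensor_tmul,
        LinearMap.rTensor_tmul, h]
      exact cls_rel f (d Y r φ) m)
  map_add' a b := hom_ext fun X x m => by
    simp [LinearMap.rTensor_add]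
  map_smul' c a := hom_ext fun X x m => by
    simp [LinearMap.rTensor_smul]

@[simp] theorem actDual_cls (d : ∀ X, R →ₗ[k] Module.End k (F.obj X).Dual)
    (h : ∀ (r : R) (X Y : C) (f : X ⟶ Y) (φ : (F.obj Y).Dual),
      d X r (RBimod.transpose (F.map f) φ) = RBimod.transpose (F.map f) (d Y r φ))
    (r : R) (X : C) (φ : (F.obj X).Dual) (m : F.obj X) :
    actDual d h r (cls F X φ m) = cls F X (d X r φ) m := by
  simp only [actDual, LinearMap.coe_mk, AddHom.coe_mk, lift_cls]
  rfl

/-- Operators `e X r` on the `F(X)`, which are natural in `X`, act on `L` by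
`φ ⊗ m ↦ φ ⊗ e X r m`. -/
noncomputable def actObj (e : ∀ X, R →ₗ[k] Module.End k (F.obj X))
    (h : ∀ (r : R) (X Y : C) (f : X ⟶ Y) (m : F.obj X),
      RBimod.toLin (F.map f) (e X r m) = e Y r (RBimod.toLin (F.map f) m)) :
    R →ₗ[k] Module.End k (Coend F) where
  toFun r := lift (fun X => of F X ∘ₗ LinearMap.lTensor (F.obj X).Dual (e X r))
    (fun X Y f φ m => by
      rw [LinearMap.comp_apply, LinearMap.comp_apply, LinearMap.lTensor_tmul,
        LinearMap.lTensor_tmul, ← h]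
      exact cls_rel f φ (e X r m))
  map_add' a b := hom_ext fun X x m => by
    simp
  map_smul' c a := hom_ext fun X x m => by
    simp

@[simp] theorem actObj_cls (e : ∀ X, R →ₗ[k] Module.End k (F.obj X))
    (h : ∀ (r : R) (X Y : C) (f : X ⟶ Y) (m : F.obj X),
      RBimod.toLin (F.map f) (e X r m) = e Y r (RBimod.toLin (F.map f) m))
    (r : R) (X : C) (φ : (F.obj X).Dual) (m : F.obj X) :
    actObj e h r (cls F X φ m) = cls F X φ (e X r m) := by
  simp only [actObj, LinearMap.coe_mk, AddHom.coe_mk, lift_cls]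
  rfl

variable (F)

/-- `σ(r)[φ ⊗ m] = [rφ ⊗ m]`. -/
noncomputable def sl : R →ₗ[k] Module.End k (Coend F) :=
  actDual (fun X => (F.obj X).dualL) (by intros; rfl)

/-- `[φ ⊗ m]σ(r) = [φr ⊗ m]`. -/
noncomputable def sr : R →ₗ[k] Module.End k (Coend F) :=
  actDual (fun X => (F.obj X).dualR) (by
    intro r X Y f φ
    ext m
    exact congrArg φ (RBimod.Hom.map_left (F.map f) r m))

/-- `τ(r)[φ ⊗ m] = [φ ⊗ rm]`. -/
noncomputable def tl : R →ₗ[k] Module.End k (Coend F) :=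
  actObj (fun X => (F.obj X).lact) (by
    intro r X Y f m
    exact RBimod.Hom.map_left (F.map f) r m)

/-- `[φ ⊗ m]τ(r) = [φ ⊗ mr]`. -/
noncomputable def tr : R →ₗ[k] Module.End k (Coend F) :=
  actObj (fun X => (F.obj X).ract) (by
    intro r X Y f m
    exact RBimod.Hom.map_right (F.map f) r m)

@[simp] theorem sl_cls (r : R) (X : C) (φ : (F.obj X).Dual) (m : F.obj X) :
    sl F r (cls F X φ m) = cls F X ((F.obj X).dualL r φ) m := actDual_cls _ _ _ _ _ _

@[simp] theorem sr_cls (r : R) (X : C) (φ : (F.obj X).Dual) (m : F.obj X) :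
    sr F r (cls F X φ m) = cls F X ((F.obj X).dualR r φ) m := actDual_cls _ _ _ _ _ _

@[simp] theorem tl_cls (r : R) (X : C) (φ : (F.obj X).Dual) (m : F.obj X) :
    tl F r (cls F X φ m) = cls F X φ (r • m) := actObj_cls _ _ _ _ _ _

@[simp] theorem tr_cls (r : R) (X : C) (φ : (F.obj X).Dual) (m : F.obj X) :
    tr F r (cls F X φ m) = cls F X φ (op r • m) := actObj_cls _ _ _ _ _ _

/-- The double bimodule structure on `L`: `σ` comes from the actions on the `F(X)^*`, `τ` from
those on the `F(X)`. -/
noncomputable def bimod : DoubleBimod k R (Coend F) where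
  sl := sl F
  sr := sr F
  tl := tl F
  tr := tr F
  sl_one z := by
    induction z using ind with
    | zero => simp only [map_zero]
    | cls X φ m => simp only [sl_cls]; congr 1; ext; simp
    | add x y hx hy => simp only [map_add, hx, hy]
  sr_one z := by
    induction z using ind with
    | zero => simp only [map_zero]
    | cls X φ m => simp only [sr_cls]; congr 1; ext; simp
    | add x y hx hy => simp only [map_add, hx, hy]
  tl_one z := by
    induction z using ind with
    | zero => simp only [map_zero]
    | cls X φ m => simp
    | add x y hx hy => simp only [map_add, hx, hy]
  tr_one z := by
    induction z using ind with
    | zero => simp only [map_zero]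
    | cls X φ m => simp
    | add x y hx hy => simp only [map_add, hx, hy]
  sl_mul a b z := by
    induction z using ind with
    | zero => simp only [map_zero]
    | cls X φ m => simp only [sl_cls]; congr 1; ext; simp [mul_assoc]
    | add x y hx hy => simp only [map_add, hx, hy]
  sr_mul a b z := by
    induction z using ind with
    | zero => simp only [map_zero]
    | cls X φ m => simp only [sr_cls]; congr 1; ext; simp [mul_smul]
    | add x y hx hy => simp only [map_add, hx, hy]
  tl_mul a b z := by
    induction z using ind with
    | zero => simp only [map_zero]
    | cls X φ m => simp [mul_smul]
    | add x y hx hy => simp only [map_add, hx, hy]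
  tr_mul a b z := by
    induction z using ind with
    | zero => simp only [map_zero]
    | cls X φ m => simp [mul_smul]
    | add x y hx hy => simp only [map_add, hx, hy]
  sl_sr a b z := by
    induction z using ind with
    | zero => simp only [map_zero]
    | cls X φ m => simp only [sl_cls, sr_cls]; congr 1
    | add x y hx hy => simp only [map_add, hx, hy]
  sl_tl a b z := by
    induction z using ind with
    | zero => simp only [map_zero]
    | cls X φ m => simp
    | add x y hx hy => simp only [map_add, hx, hy]
  sl_tr a b z := by
    induction z using ind with
    | zero => simp only [map_zero]
    | cls X φ m => simp
    | add x y hx hy => simp only [map_add, hx, hy]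
  sr_tl a b z := by
    induction z using ind with
    | zero => simp only [map_zero]
    | cls X φ m => simp
    | add x y hx hy => simp only [map_add, hx, hy]
  sr_tr a b z := by
    induction z using ind with
    | zero => simp only [map_zero]
    | cls X φ m => simp
    | add x y hx hy => simp only [map_add, hx, hy]
  tl_tr a b z := by
    induction z using ind with
    | zero => simp only [map_zero]
    | cls X φ m => simp [smul_comm]
    | add x y hx hy => simp only [map_add, hx, hy]
end Coend

/-! ### Monoidal functors to bimodules -/

/-- A bimodule map `M → R` as an element of `M^*`. -/
def RBimod.toDual {M : RBimod k R} (f : M ⟶ RBimod.unit k R) : M.Dual where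
  toFun m := RBimod.toLin f m
  map_add' x y := map_add (RBimod.toLin f) x y
  map_smul' r x := RBimod.Hom.map_right f r.unop x

/-- The value at `x ⊗ y` of a map `M ⊗_R N → P`. -/
def RBimod.app₂ {M N P : RBimod k R} (f : M.tensor N ⟶ P) (x : M) (y : N) : P :=
  RBimod.toLin f (RBimod.tmul x y : M.Tens N)

/-- A monoidal structure on a functor `F` to `R`-bimodules: natural isomorphisms
`θ : F(X) ⊗_R F(Y) ≅ F(X ⊗ Y)` and an isomorphism `η : F(I) ≅ R`, compatible with the
associativity and unit constraints. All identities are stated on elements `x ⊗ y` (resp.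
`x ⊗ y ⊗ z`), which generate the tensor products. -/
structure MonoidalStr [MonoidalCategory C] where
  /-- `F(X) ⊗_R F(Y) ≅ F(X ⊗ Y)` -/
  θ : ∀ X Y : C, (F.obj X).tensor (F.obj Y) ≅ F.obj (X ⊗ Y)
  /-- `F(I) ≅ R` -/
  η : F.obj (𝟙_ C) ≅ RBimod.unit k R
  θ_natural : ∀ {X X' Y Y' : C} (f : X ⟶ X') (g : Y ⟶ Y') (x : F.obj X) (y : F.obj Y),
    RBimod.app₂ (θ X' Y').hom (RBimod.toLin (F.map f) x) (RBimod.toLin (F.map g) y) =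
      RBimod.toLin (F.map (f ⊗ₘ g)) (RBimod.app₂ (θ X Y).hom x y)
  θ_assoc : ∀ {X Y Z : C} (x : F.obj X) (y : F.obj Y) (z : F.obj Z),
    RBimod.toLin (F.map (α_ X Y Z).hom)
        (RBimod.app₂ (θ (X ⊗ Y) Z).hom (RBimod.app₂ (θ X Y).hom x y) z) =
      RBimod.app₂ (θ X (Y ⊗ Z)).hom x (RBimod.app₂ (θ Y Z).hom y z)
  θ_unit_left : ∀ {X : C} (e : F.obj (𝟙_ C)) (x : F.obj X),
    RBimod.toLin (F.map (λ_ X).hom) (RBimod.app₂ (θ (𝟙_ C) X).hom e x) =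
      RBimod.toDual η.hom e • x
  θ_unit_right : ∀ {X : C} (x : F.obj X) (e : F.obj (𝟙_ C)),
    RBimod.toLin (F.map (ρ_ X).hom) (RBimod.app₂ (θ X (𝟙_ C)).hom x e) =
      op (RBimod.toDual η.hom e) • x

variable {F}

/-- The map `F(Y) → F(X)^*` induced by `ev : Y ⊗ X ⟶ I`: the functional attached to `ξ ∈ F(Y)` is
`m ↦ η(F(ev)(θ(ξ ⊗ m)))`. -/
def MonoidalStr.pairing [MonoidalCategory C] (S : MonoidalStr F) {X Y : C} (ev : Y ⊗ X ⟶ 𝟙_ C)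
    (ξ : F.obj Y) : (F.obj X).Dual where
  toFun m := RBimod.toDual S.η.hom (RBimod.toLin (F.map ev) (RBimod.app₂ (S.θ Y X).hom ξ m))
  map_add' x y := by
    have h : RBimod.app₂ (S.θ Y X).hom ξ (x + y) =
        RBimod.app₂ (S.θ Y X).hom ξ x + RBimod.app₂ (S.θ Y X).hom ξ y := by
      simp only [RBimod.app₂, RBimod.tmul, Bal.tmul, TensorProduct.tmul_add, map_add]
      exact map_add (RBimod.toLin (S.θ Y X).hom) _ _
    rw [h, map_add, map_add]
  map_smul' r x := by
    have h : RBimod.app₂ (S.θ Y X).hom ξ (r • x) = r • RBimod.app₂ (S.θ Y X).hom ξ x :=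
      RBimod.Hom.map_right (S.θ Y X).hom r.unop (RBimod.tmul ξ x : (F.obj Y).Tens (F.obj X))
    have h' (z : F.obj (Y ⊗ X)) :
        RBimod.toLin (F.map ev) (r • z) = r • RBimod.toLin (F.map ev) z :=
      RBimod.Hom.map_right (F.map ev) r.unop z
    rw [h, h', map_smul, RingHom.id_apply]

/-- Every object `X` has a left dual `Y = X^*`, with `ev : X^* ⊗ X ⟶ I` and
`db : I ⟶ X ⊗ X^*` satisfying the triangle identities. -/
def IsLeftRigidCat (C : Type w₁) [Category.{w₂} C] [MonoidalCategory C] : Prop :=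
  ∀ X : C, ∃ Y : C, Nonempty (ExactPairing X Y)

/-- Every object `X` has a right dual `Y = ^*X`, with `ev : X ⊗ ^*X ⟶ I` and
`db : I ⟶ ^*X ⊗ X` satisfying the triangle identities. -/
def IsRightRigidCat (C : Type w₁) [Category.{w₂} C] [MonoidalCategory C] : Prop :=
  ∀ X : C, ∃ Y : C, Nonempty (ExactPairing Y X)

end CoendSection

end Tannaka

open Tannaka

universe u w v₁ v₂

/-! Everything is checked on the classes $[\varphi\otimes m]$, which generate $L$. The engine is the
canonical element $\sum e_i\otimes e^i$ of $M\otimes_R M^*$: it does not depend on the dual bases,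
and a right linear map $f:M\to N$ carries it to $\sum f(e_i)\otimes e^i=\sum d_j\otimes d^jf$ in
$N\otimes_R M^*$ (`IsDualBasis.sum_eq`). For $F(f)$ this makes $\Delta$ well defined on the coend.
For left multiplication by $a\in R$ it gives the Takeuchi condition $\sum\tau(a)h_1\otimes h_2=\sum
h_1\otimes h_2\sigma(a)$ (`tlTS_comul`), without which $\sum h_1\circ g_1\otimes h_2\circ g_2$ would
have no meaning.

Via $\theta$, products of dual bases of $F(X)$ and $F(Y)$ are dual bases of $F(X\otimes Y)$
(`isDualBasis_tmul`), so $\Delta$ is multiplicative. Associativity and unitality of the product are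
the coend relations along the associator and the unitors.

For the antipodes, $F$ preserves duals: if $Y$ is a left dual of $X$ and
$F(\mathrm{db})\eta^{-1}(1)=\sum\theta(x_i\otimes y_i)$, the triangle identities say that $x_i,\hat
y_i$ are dual bases of $F(X)$ and that $\xi=\sum\hat\xi(x_i)y_i$ (`exists_coevaluation_eq`). Hence
$\xi\mapsto\hat\xi$ identifies $F(Y)$ with $F(X)^*$, and the formula for $\nabla$ makes sense; it is
natural because a morphism $X\to X'$ has a transpose between the duals. In each antipode identity
the product produces a class at $X^*\otimes X$ or $X\otimes X^*$ (with ${}^*X$ in the opposite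
case), which the coend relation along $\mathrm{ev}$ or $\mathrm{db}$ moves to $I$. There every class
is a multiple of $1$ (`clsLin_unit`), and the scalar, carried across the tensor sign, rebuilds $h$.
For $\nabla$ the first identity uses $\mathrm{ev}$ and the second $\mathrm{db}$; for $\nabla^{\rm
op}$ it is the other way round. -/

namespace Tannaka

/-! ### Dual bases and the canonical element -/

section DualBases

variable {k : Type u} {R : Type w} [CommRing k] [Ring R] [Algebra k R]

namespace RBimod

theorem dual_op_smul {M : RBimod k R} (φ : M.Dual) (a : R) (m : M) :
    φ (op a • m) = φ m * a := by
  rw [map_smul]; rfl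

theorem toLin_smul {M N : RBimod k R} (f : M ⟶ N) (a : R) (x : M) :
    toLin f (a • x) = a • toLin f x := Hom.map_left f a x

theorem toLin_op_smul {M N : RBimod k R} (f : M ⟶ N) (a : R) (x : M) :
    toLin f (op a • x) = op a • toLin f x := Hom.map_right f a x

theorem toLin_hom_inv {M N : RBimod k R} (f : M ≅ N) (x : N) :
    toLin f.hom (toLin f.inv x) = x :=
  congrArg (fun g : N ⟶ N => toLin g x) f.inv_hom_id

theorem toLin_inv_hom {M N : RBimod k R} (f : M ≅ N) (x : M) :
    toLin f.inv (toLin f.hom x) = x :=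
  congrArg (fun g : M ⟶ M => toLin g x) f.hom_inv_id

/-- Projectivity splits a surjection from a free right module of finite rank: the $e_i$ are the
images of the standard basis, the $e^i$ the coordinates of the section. -/
theorem IsLeftRigid.exists_isDualBasis {M : RBimod k R} (h : M.IsLeftRigid) :
    ∃ (n : ℕ) (e : Fin n → M) (e' : Fin n → M.Dual), M.IsDualBasis e e' := by
  obtain ⟨h₁, h₂⟩ := h
  obtain ⟨n, p, hp⟩ := Module.Finite.exists_fin' Rᵐᵒᵖ M
  obtain ⟨s, hs⟩ := Module.projective_lifting_property p LinearMap.id hp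
  refine ⟨n, fun i => p (Pi.single i 1), fun i =>
    { toFun := fun m => (s m i).unop
      map_add' := fun x y => by simp
      map_smul' := fun a x => by simp }, fun m => ?_⟩
  have h : m = p (s m) := (LinearMap.congr_fun hs m).symm
  conv_lhs => rw [h, pi_eq_sum_univ' (s m), map_sum]
  refine Finset.sum_congr rfl fun i _ => ?_
  rw [map_smul]
  simp only [LinearMap.coe_mk, AddHom.coe_mk, op_unop]

theorem IsDualBasis.dual_eq {M : RBimod k R} {n : ℕ} {e : Fin n → M} {e' : Fin n → M.Dual}
    (h : M.IsDualBasis e e') (φ : M.Dual) : ∑ i, M.dualL (φ (e i)) (e' i) = φ := by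
  ext m
  conv_rhs => rw [h m, map_sum]
  rw [LinearMap.sum_apply]
  exact Finset.sum_congr rfl fun i _ => (dual_op_smul _ _ _).symm

/-- The canonical element `∑ e_i ⊗ e^i` is natural with respect to maps of right modules. -/
theorem IsDualBasis.sum_eq {M N : RBimod k R} {n n' : ℕ} {e : Fin n → M} {e' : Fin n → M.Dual}
    {d : Fin n' → N} {d' : Fin n' → N.Dual} (he : M.IsDualBasis e e') (hd : N.IsDualBasis d d')
    {A : Type*} [AddCommGroup A] [Module k A] (β : N →ₗ[k] M.Dual →ₗ[k] A)
    (hβ : ∀ a x φ, β (op a • x) φ = β x (M.dualL a φ)) (f : M → N) (f' : N.Dual → M.Dual)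
    (hf : ∀ ψ m, f' ψ m = ψ (f m)) :
    ∑ i, β (f (e i)) (e' i) = ∑ j, β (d j) (f' (d' j)) := by
  -- Expand $f(e_i)$ in the basis $d$ and move the coefficients across by balance; the sum over $i$
  -- is then the expansion of $f'(d^j)$ by `dual_eq`.
  have h₁ (i : Fin n) : β (f (e i)) (e' i) =
      ∑ j, β (d j) (M.dualL (d' j (f (e i))) (e' i)) := by
    conv_lhs => rw [hd (f (e i)), map_sum, LinearMap.sum_apply]
    exact Finset.sum_congr rfl fun j _ => hβ _ _ _
  simp only [h₁]
  rw [Finset.sum_comm]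
  refine Finset.sum_congr rfl fun j _ => ?_
  rw [← map_sum]
  conv_rhs => rw [← he.dual_eq (f' (d' j))]
  simp only [hf]

end RBimod

end DualBases

/-! ### The monoidal functor on elements -/

section MonoidalStr

variable {k : Type u} {R : Type w} [CommRing k] [Ring R] [Algebra k R]
  {C : Type v₁} [Category.{v₂} C] {F : C ⥤ RBimod k R}

theorem RBimod.toLin_map_comp {X Y Z : C} (f : X ⟶ Y) (g : Y ⟶ Z) (x : F.obj X) :
    RBimod.toLin (F.map (f ≫ g)) x = RBimod.toLin (F.map g) (RBimod.toLin (F.map f) x) := by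
  rw [F.map_comp]; rfl

theorem RBimod.toLin_map_id {X : C} (x : F.obj X) :
    RBimod.toLin (F.map (𝟙 X)) x = x := by
  rw [F.map_id]; rfl

variable [MonoidalCategory C]

namespace MonoidalStr

variable (S : MonoidalStr F)

/-- The map `F(X) × F(Y) → F(X ⊗ Y)` induced by `θ`. -/
def tmul (X Y : C) : F.obj X →ₗ[k] F.obj Y →ₗ[k] F.obj (X ⊗ Y) :=
  TensorProduct.curry ((RBimod.toLin (S.θ X Y).hom).comp
    (Bal.mk (fun r => (F.obj X).ract r) (fun r => (F.obj Y).lact r)))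

theorem tmul_op_smul {X Y : C} (a : R) (x : F.obj X) (y : F.obj Y) :
    S.tmul X Y (op a • x) y = S.tmul X Y x (a • y) :=
  congrArg (RBimod.toLin (S.θ X Y).hom)
    (Bal.tmul_bal (f := fun r => (F.obj X).ract r) (g := fun r => (F.obj Y).lact r) a x y)

theorem smul_tmul {X Y : C} (a : R) (x : F.obj X) (y : F.obj Y) :
    S.tmul X Y (a • x) y = a • S.tmul X Y x y :=
  RBimod.toLin_smul (S.θ X Y).hom a (RBimod.tmul x y : (F.obj X).Tens (F.obj Y))

theorem op_smul_tmul {X Y : C} (a : R) (x : F.obj X) (y : F.obj Y) :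
    S.tmul X Y x (op a • y) = op a • S.tmul X Y x y :=
  RBimod.toLin_op_smul (S.θ X Y).hom a (RBimod.tmul x y : (F.obj X).Tens (F.obj Y))

/-- Since $\theta$ is an isomorphism, $F(X\otimes Y)$ is generated by the elements $\theta(x\otimes
y)$ under addition alone. Functionals on $F(X\otimes Y)$ can therefore be compared on these. -/
theorem tmul_induction {X Y : C} {p : F.obj (X ⊗ Y) → Prop}
    (tmul : ∀ x y, p (S.tmul X Y x y)) (add : ∀ x y, p x → p y → p (x + y))
    (z : F.obj (X ⊗ Y)) : p z := by
  rw [← RBimod.toLin_hom_inv (S.θ X Y) z]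
  generalize RBimod.toLin (S.θ X Y).inv z = t
  refine Bal.ind (f := fun r => (F.obj X).ract r) (g := fun r => (F.obj Y).lact r)
    (p := fun t => p (RBimod.toLin (S.θ X Y).hom t)) tmul (fun x y hx hy => ?_) t
  exact (map_add (RBimod.toLin (S.θ X Y).hom) x y).symm ▸ add _ _ hx hy

theorem exists_eq_sum_tmul {X Y : C} (z : F.obj (X ⊗ Y)) :
    ∃ (n : ℕ) (x : Fin n → F.obj X) (y : Fin n → F.obj Y), z = ∑ i, S.tmul X Y (x i) (y i) := by
  induction z using S.tmul_induction with
  | tmul x y => exact ⟨1, fun _ => x, fun _ => y, by simp⟩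
  | add z z' h h' =>
    obtain ⟨n, x, y, rfl⟩ := h
    obtain ⟨n', x', y', rfl⟩ := h'
    exact ⟨n + n', Fin.append x x', Fin.append y y', by simp [Fin.sum_univ_add]⟩

theorem dual_ext {X Y : C} {φ ψ : (F.obj (X ⊗ Y)).Dual}
    (h : ∀ x y, φ (S.tmul X Y x y) = ψ (S.tmul X Y x y)) : φ = ψ := by
  ext z
  induction z using S.tmul_induction with
  | tmul x y => exact h x y
  | add x y hx hy => rw [map_add, map_add, hx, hy]

theorem transpose_dualTens_tmul {X Y : C} (φ : (F.obj X).Dual) (ψ : (F.obj Y).Dual)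
    (x : F.obj X) (y : F.obj Y) :
    RBimod.transpose (S.θ X Y).inv (RBimod.dualTens φ ψ) (S.tmul X Y x y) = ψ (φ x • y) :=
  congrArg (RBimod.dualTens φ ψ)
    (RBimod.toLin_inv_hom (S.θ X Y) (RBimod.tmul x y : (F.obj X).Tens (F.obj Y)))

/-- The functional `θ(x ⊗ y) ↦ ψ(φ(x)y)` on `F(X ⊗ Y)`. -/
def dualMul (X Y : C) : (F.obj X).Dual →ₗ[k] (F.obj Y).Dual →ₗ[k] (F.obj (X ⊗ Y)).Dual :=
  LinearMap.mk₂ k (fun φ ψ => RBimod.transpose (S.θ X Y).inv (RBimod.dualTens φ ψ))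
    (fun φ φ' ψ => S.dual_ext fun x y => by
      simp only [transpose_dualTens_tmul, LinearMap.add_apply, add_smul, map_add])
    (fun c φ ψ => S.dual_ext fun x y => by
      simp only [transpose_dualTens_tmul, LinearMap.smul_apply, smul_assoc, RBimod.dual_smul])
    (fun φ ψ ψ' => S.dual_ext fun x y => by
      simp only [transpose_dualTens_tmul, LinearMap.add_apply])
    (fun c φ ψ => S.dual_ext fun x y => by
      simp only [transpose_dualTens_tmul, LinearMap.smul_apply])

@[simp] theorem dualMul_tmul {X Y : C} (φ : (F.obj X).Dual) (ψ : (F.obj Y).Dual)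
    (x : F.obj X) (y : F.obj Y) : S.dualMul X Y φ ψ (S.tmul X Y x y) = ψ (φ x • y) :=
  S.transpose_dualTens_tmul φ ψ x y

/-- Dualizing reverses the order of the factors, as in $F(Y)^*\otimes_R F(X)^*$. This is the source
of the crossed $\sigma$-relation in $\boxtimes$. -/
theorem dualMul_dualL {X Y : C} (a : R) (φ : (F.obj X).Dual) (ψ : (F.obj Y).Dual) :
    S.dualMul X Y ((F.obj X).dualL a φ) ψ = S.dualMul X Y φ ((F.obj Y).dualR a ψ) :=
  S.dual_ext fun x y => by simp [mul_smul]

theorem dualMul_dualR {X Y : C} (a : R) (φ : (F.obj X).Dual) (ψ : (F.obj Y).Dual) :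
    S.dualMul X Y ((F.obj X).dualR a φ) ψ = (F.obj (X ⊗ Y)).dualR a (S.dualMul X Y φ ψ) :=
  S.dual_ext fun x y => by simp [← smul_tmul]

theorem dualL_dualMul {X Y : C} (a : R) (φ : (F.obj X).Dual) (ψ : (F.obj Y).Dual) :
    S.dualMul X Y φ ((F.obj Y).dualL a ψ) = (F.obj (X ⊗ Y)).dualL a (S.dualMul X Y φ ψ) :=
  S.dual_ext fun x y => by simp

/-- Expand $x$, push the coefficient $e^i(x)$ through the tensor sign onto $y$, and expand
$e^i(x)y$. This is what makes $\Delta$ multiplicative. -/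
theorem isDualBasis_tmul {X Y : C} {n n' : ℕ} {e : Fin n → F.obj X} {e' : Fin n → (F.obj X).Dual}
    {d : Fin n' → F.obj Y} {d' : Fin n' → (F.obj Y).Dual} (he : (F.obj X).IsDualBasis e e')
    (hd : (F.obj Y).IsDualBasis d d') (z : F.obj (X ⊗ Y)) :
    z = ∑ i, ∑ j, op (S.dualMul X Y (e' i) (d' j) z) • S.tmul X Y (e i) (d j) := by
  induction z using S.tmul_induction with
  | tmul x y =>
    conv_lhs => rw [he x, map_sum, LinearMap.sum_apply]
    refine Finset.sum_congr rfl fun i _ => ?_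
    rw [tmul_op_smul]
    conv_lhs => rw [hd (e' i x • y), map_sum]
    simp only [dualMul_tmul, op_smul_tmul]
  | add x y hx hy =>
    conv_lhs => rw [hx, hy]
    simp only [← Finset.sum_add_distrib]
    refine Finset.sum_congr rfl fun i _ => Finset.sum_congr rfl fun j _ => ?_
    rw [map_add]
    exact (add_smul (op _) (op _) _).symm

theorem map_tmul {X X' Y Y' : C} (f : X ⟶ X') (g : Y ⟶ Y') (x : F.obj X) (y : F.obj Y) :
    RBimod.toLin (F.map (f ⊗ₘ g)) (S.tmul X Y x y) =
      S.tmul X' Y' (RBimod.toLin (F.map f) x) (RBimod.toLin (F.map g) y) :=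
  (S.θ_natural f g x y).symm

theorem map_whiskerRight_tmul {X X' Y : C} (f : X ⟶ X') (x : F.obj X) (y : F.obj Y) :
    RBimod.toLin (F.map (f ▷ Y)) (S.tmul X Y x y) =
      S.tmul X' Y (RBimod.toLin (F.map f) x) y := by
  rw [← tensorHom_id, map_tmul, RBimod.toLin_map_id]

theorem map_whiskerLeft_tmul {X Y Y' : C} (g : Y ⟶ Y') (x : F.obj X) (y : F.obj Y) :
    RBimod.toLin (F.map (X ◁ g)) (S.tmul X Y x y) =
      S.tmul X Y' x (RBimod.toLin (F.map g) y) := by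
  rw [← id_tensorHom, map_tmul, RBimod.toLin_map_id]

theorem map_associator_hom {X Y Z : C} (x : F.obj X) (y : F.obj Y) (z : F.obj Z) :
    RBimod.toLin (F.map (α_ X Y Z).hom) (S.tmul (X ⊗ Y) Z (S.tmul X Y x y) z) =
      S.tmul X (Y ⊗ Z) x (S.tmul Y Z y z) :=
  S.θ_assoc x y z

theorem map_associator_inv {X Y Z : C} (x : F.obj X) (y : F.obj Y) (z : F.obj Z) :
    RBimod.toLin (F.map (α_ X Y Z).inv) (S.tmul X (Y ⊗ Z) x (S.tmul Y Z y z)) =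
      S.tmul (X ⊗ Y) Z (S.tmul X Y x y) z := by
  rw [← map_associator_hom, ← RBimod.toLin_map_comp, Iso.hom_inv_id, RBimod.toLin_map_id]

/-- The map `η : F(I) → R` as an element of `F(I)^*`. -/
def counit : (F.obj (𝟙_ C)).Dual := RBimod.toDual S.η.hom

/-- The inverse `R → F(I)` of `η`. -/
def unit : R →ₗ[k] F.obj (𝟙_ C) := RBimod.toLin S.η.inv

@[simp] theorem counit_unit (a : R) : S.counit (S.unit a) = a :=
  RBimod.toLin_hom_inv S.η a

@[simp] theorem unit_counit (e : F.obj (𝟙_ C)) : S.unit (S.counit e) = e :=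
  RBimod.toLin_inv_hom S.η e

theorem counit_smul (a : R) (e : F.obj (𝟙_ C)) : S.counit (a • e) = a * S.counit e :=
  RBimod.toLin_smul S.η.hom a e

theorem smul_unit (a b : R) : a • S.unit b = S.unit (a * b) :=
  (RBimod.toLin_smul S.η.inv a (b : RBimod.unit k R)).symm

theorem op_smul_unit (a b : R) : op a • S.unit b = S.unit (b * a) :=
  (RBimod.toLin_op_smul S.η.inv a (b : RBimod.unit k R)).symm

theorem isDualBasis_unit :
    (F.obj (𝟙_ C)).IsDualBasis (fun _ : Fin 1 => S.unit 1) (fun _ => S.counit) := fun m => by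
  simp [op_smul_unit]

theorem map_leftUnitor_tmul {X : C} (e : F.obj (𝟙_ C)) (x : F.obj X) :
    RBimod.toLin (F.map (λ_ X).hom) (S.tmul (𝟙_ C) X e x) = S.counit e • x :=
  S.θ_unit_left e x

theorem map_rightUnitor_tmul {X : C} (x : F.obj X) (e : F.obj (𝟙_ C)) :
    RBimod.toLin (F.map (ρ_ X).hom) (S.tmul X (𝟙_ C) x e) = op (S.counit e) • x :=
  S.θ_unit_right x e

/-! #### The pairing attached to a morphism `Y ⊗ X ⟶ I` -/

variable {X Y : C} (ev : Y ⊗ X ⟶ 𝟙_ C)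

theorem pairing_apply (ξ : F.obj Y) (m : F.obj X) :
    S.pairing ev ξ m = S.counit (RBimod.toLin (F.map ev) (S.tmul Y X ξ m)) := rfl

/-- `MonoidalStr.pairing` as a linear map. -/
def pairingLin : F.obj Y →ₗ[k] (F.obj X).Dual where
  toFun := S.pairing ev
  map_add' x y := by ext m; simp [pairing_apply]
  map_smul' c x := by ext m; simp [pairing_apply]

theorem pairingLin_apply (ξ : F.obj Y) (m : F.obj X) :
    S.pairingLin ev ξ m = S.counit (RBimod.toLin (F.map ev) (S.tmul Y X ξ m)) := rfl

theorem pairingLin_smul (a : R) (ξ : F.obj Y) :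
    S.pairingLin ev (a • ξ) = (F.obj X).dualL a (S.pairingLin ev ξ) := by
  ext m
  simp [pairingLin_apply, smul_tmul, RBimod.toLin_smul, counit_smul]

theorem pairingLin_op_smul (a : R) (ξ : F.obj Y) :
    S.pairingLin ev (op a • ξ) = (F.obj X).dualR a (S.pairingLin ev ξ) := by
  ext m
  simp [pairingLin_apply, tmul_op_smul]


end MonoidalStr

end MonoidalStr

/-! ### Independence of representatives -/

section Balanced

variable {k : Type*} [CommRing k] {ι : Type*}
  {M : Type*} [AddCommGroup M] [Module k M] {N : Type*} [AddCommGroup N] [Module k N]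
  {A : Type*} [AddCommGroup A] [Module k A] {f : ι → Module.End k M} {g : ι → Module.End k N}

/-- The axioms in Sweedler notation quantify over all representatives in $L\otimes_k L$. Once an
expression is known to be balanced, this turns it into a linear map on the quotient, where it can be
evaluated on any convenient representative. -/
theorem Bal.lift_of_mk_eq {φ : M ⊗[k] N →ₗ[k] A}
    (hφ : ∀ i m n, φ (f i m ⊗ₜ[k] n) = φ (m ⊗ₜ[k] g i n)) {z : Bal f g} {Z : M ⊗[k] N}
    (hZ : Bal.mk f g Z = z) : φ Z = Bal.lift φ hφ z := by
  rw [← hZ]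
  rfl

end Balanced

/-! ### The coend as a coalgebroid -/

section CoendSection

variable {k : Type u} {R : Type w} [CommRing k] [Ring R] [Algebra k R]
  {C : Type v₁} [Category.{v₂} C] (F : C ⥤ RBimod k R)

namespace Coend

open DoubleBimod

/-- The bilinear map `φ, m ↦ [φ ⊗ m]`. -/
noncomputable def clsLin (X : C) : (F.obj X).Dual →ₗ[k] F.obj X →ₗ[k] Coend F :=
  TensorProduct.curry (of F X)

/-- The bilinear map to `L τ⊗σ L`. -/
noncomputable def tsTmul : Coend F →ₗ[k] Coend F →ₗ[k] TS (bimod F) (bimod F) :=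
  TensorProduct.curry (mkTS _ _)

/-- The bilinear map to `L σ⊗σ L`. -/
noncomputable def ssTmul : Coend F →ₗ[k] Coend F →ₗ[k] SS (bimod F) (bimod F) :=
  TensorProduct.curry (mkSS _ _)

/-- The bilinear map to `L τ⊗τ L`. -/
noncomputable def ttTmul : Coend F →ₗ[k] Coend F →ₗ[k] TT (bimod F) (bimod F) :=
  TensorProduct.curry (mkTT _ _)

variable {F}

theorem cls_eq (X : C) (φ : (F.obj X).Dual) (m : F.obj X) : cls F X φ m = clsLin F X φ m := rfl

theorem mkTS_tmul (x y : Coend F) : mkTS (bimod F) (bimod F) (x ⊗ₜ[k] y) = tsTmul F x y := rfl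

theorem hom_ext_clsLin {A : Type*} [AddCommGroup A] [Module k A] {φ ψ : Coend F →ₗ[k] A}
    (h : ∀ X x m, φ (clsLin F X x m) = ψ (clsLin F X x m)) : φ = ψ :=
  hom_ext h

theorem apply_eq_of_clsLin {A : Type*} [AddCommGroup A] [Module k A] (φ ψ : Coend F →ₗ[k] A)
    (h : ∀ X x m, φ (clsLin F X x m) = ψ (clsLin F X x m)) (z : Coend F) : φ z = ψ z :=
  LinearMap.congr_fun (hom_ext_clsLin h) z

theorem apply_eq_of_clsLin₂ {A : Type*} [AddCommGroup A] [Module k A]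
    (φ ψ : Coend F →ₗ[k] Coend F →ₗ[k] A)
    (h : ∀ X x m Y y n, φ (clsLin F X x m) (clsLin F Y y n) =
      ψ (clsLin F X x m) (clsLin F Y y n)) (z z' : Coend F) : φ z z' = ψ z z' :=
  LinearMap.congr_fun (apply_eq_of_clsLin φ ψ (fun X x m => hom_ext_clsLin (h X x m)) z) z'

theorem clsLin_transpose {X Y : C} (f : X ⟶ Y) (φ : (F.obj Y).Dual) (m : F.obj X) :
    clsLin F X (RBimod.transpose (F.map f) φ) m =
      clsLin F Y φ (RBimod.toLin (F.map f) m) := cls_rel f φ m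

/-- The coend relation for a functional which is given by its values. -/
theorem clsLin_eq {X Y : C} (f : X ⟶ Y) {ψ : (F.obj X).Dual} {φ : (F.obj Y).Dual}
    {m : F.obj X} {n : F.obj Y} (hφ : ∀ x, φ (RBimod.toLin (F.map f) x) = ψ x)
    (hm : RBimod.toLin (F.map f) m = n) : clsLin F X ψ m = clsLin F Y φ n := by
  rw [← hm, ← clsLin_transpose]
  congr 2
  ext x
  exact (hφ x).symm

@[simp] theorem bimod_sl (a : R) (X : C) (φ : (F.obj X).Dual) (m : F.obj X) :
    (bimod F).sl a (clsLin F X φ m) = clsLin F X ((F.obj X).dualL a φ) m := sl_cls F a X φ m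

@[simp] theorem bimod_sr (a : R) (X : C) (φ : (F.obj X).Dual) (m : F.obj X) :
    (bimod F).sr a (clsLin F X φ m) = clsLin F X ((F.obj X).dualR a φ) m := sr_cls F a X φ m

@[simp] theorem bimod_tl (a : R) (X : C) (φ : (F.obj X).Dual) (m : F.obj X) :
    (bimod F).tl a (clsLin F X φ m) = clsLin F X φ (a • m) := tl_cls F a X φ m

@[simp] theorem bimod_tr (a : R) (X : C) (φ : (F.obj X).Dual) (m : F.obj X) :
    (bimod F).tr a (clsLin F X φ m) = clsLin F X φ (op a • m) := tr_cls F a X φ m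

theorem tsTmul_tr (a : R) (x y : Coend F) :
    tsTmul F ((bimod F).tr a x) y = tsTmul F x ((bimod F).sl a y) :=
  Bal.tmul_bal (f := fun a => (bimod F).tr a) (g := fun a => (bimod F).sl a) a x y

theorem ssTmul_sl (a : R) (x y : Coend F) :
    ssTmul F ((bimod F).sl a x) y = ssTmul F x ((bimod F).sr a y) :=
  Bal.tmul_bal (f := fun a => (bimod F).sl a) (g := fun a => (bimod F).sr a) a x y

theorem ttTmul_tr (a : R) (x y : Coend F) :
    ttTmul F ((bimod F).tr a x) y = ttTmul F x ((bimod F).tl a y) :=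
  Bal.tmul_bal (f := fun a => (bimod F).tr a) (g := fun a => (bimod F).tl a) a x y

theorem ts_hom_ext {A : Type*} [AddCommGroup A] [Module k A]
    {φ ψ : TS (bimod F) (bimod F) →ₗ[k] A}
    (h : ∀ x y, φ (tsTmul F x y) = ψ (tsTmul F x y)) : φ = ψ :=
  Bal.hom_ext h

@[simp] theorem ts_sl_tsTmul (a : R) (x y : Coend F) :
    ((bimod F).ts (bimod F)).sl a (tsTmul F x y) = tsTmul F ((bimod F).sl a x) y := rfl

@[simp] theorem ts_sr_tsTmul (a : R) (x y : Coend F) :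
    ((bimod F).ts (bimod F)).sr a (tsTmul F x y) = tsTmul F ((bimod F).sr a x) y := rfl

@[simp] theorem ts_tl_tsTmul (a : R) (x y : Coend F) :
    ((bimod F).ts (bimod F)).tl a (tsTmul F x y) = tsTmul F x ((bimod F).tl a y) := rfl

@[simp] theorem ts_tr_tsTmul (a : R) (x y : Coend F) :
    ((bimod F).ts (bimod F)).tr a (tsTmul F x y) = tsTmul F x ((bimod F).tr a y) := rfl

variable (F) in
/-- The operators `x ⊗ y ↦ τ(a)x ⊗ y` on `L σ⊗σ L`. -/
noncomputable def tlSS : R →ₗ[k] Module.End k (SS (bimod F) (bimod F)) :=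
  Bal.actL (bimod F).tl (fun a b h => ((bimod F).sl_tl b a h).symm)

theorem tlSS_ssTmul (a : R) (x y : Coend F) :
    tlSS F a (ssTmul F x y) = ssTmul F ((bimod F).tl a x) y := rfl

variable (F) in
/-- The operators `x ⊗ y ↦ xσ(a) ⊗ y` on `L τ⊗τ L`. -/
noncomputable def srTT : R →ₗ[k] Module.End k (TT (bimod F) (bimod F)) :=
  Bal.actL (bimod F).sr (fun a b h => (bimod F).sr_tr a b h)

theorem srTT_ttTmul (a : R) (x y : Coend F) :
    srTT F a (ttTmul F x y) = ttTmul F ((bimod F).sr a x) y := rfl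

/-! #### The coproduct and the counit -/

/-- The relation defining $L\,{}_\tau\!\otimes^\sigma L$ is exactly the balance that
`IsDualBasis.sum_eq` asks for. The maps are not required to come from $\mathcal C$, so that left
multiplication by $a\in R$ is allowed. -/
theorem sum_tsTmul_eq {X Y : C} {n n' : ℕ} {e : Fin n → F.obj X} {e' : Fin n → (F.obj X).Dual}
    {d : Fin n' → F.obj Y} {d' : Fin n' → (F.obj Y).Dual} (he : (F.obj X).IsDualBasis e e')
    (hd : (F.obj Y).IsDualBasis d d') (φ : (F.obj Y).Dual) (m : F.obj X)
    (f : F.obj X → F.obj Y) (f' : (F.obj Y).Dual → (F.obj X).Dual)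
    (hf : ∀ ψ m, f' ψ m = ψ (f m)) :
    ∑ i, tsTmul F (clsLin F Y φ (f (e i))) (clsLin F X (e' i) m) =
      ∑ j, tsTmul F (clsLin F Y φ (d j)) (clsLin F X (f' (d' j)) m) :=
  he.sum_eq hd ((tsTmul F).compl₁₂ (clsLin F Y φ) ((clsLin F X).flip m))
    (fun a x ψ => by
      simp only [LinearMap.compl₁₂_apply, LinearMap.flip_apply]
      rw [← bimod_tr, tsTmul_tr, bimod_sl]) f f' hf

variable (hF : ∀ X, (F.obj X).IsLeftRigid)

/-- The coproduct on the summand at `X`, computed with the dual bases `e`, `e'`. -/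
noncomputable def comulAt (X : C) {n : ℕ} (e : Fin n → F.obj X) (e' : Fin n → (F.obj X).Dual) :
    (F.obj X).Dual ⊗[k] (F.obj X) →ₗ[k] TS (bimod F) (bimod F) :=
  TensorProduct.lift (∑ i, (tsTmul F).compl₁₂ ((clsLin F X).flip (e i)) (clsLin F X (e' i)))

theorem comulAt_tmul (X : C) {n : ℕ} (e : Fin n → F.obj X) (e' : Fin n → (F.obj X).Dual)
    (φ : (F.obj X).Dual) (m : F.obj X) : comulAt X e e' (φ ⊗ₜ[k] m) =
      ∑ i, tsTmul F (clsLin F X φ (e i)) (clsLin F X (e' i) m) := by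
  simp [comulAt, LinearMap.sum_apply]

/-- The coend relation in the first factor puts $F(f)$ on $e_i$, naturality of the canonical element
moves it to the second factor, and the coend relation there puts it on $m$. Both dual bases are
arbitrary, so the case of an identity also shows independence of the basis. -/
theorem comulAt_transpose {X Y : C} {n n' : ℕ} {e : Fin n → F.obj X}
    {e' : Fin n → (F.obj X).Dual} {d : Fin n' → F.obj Y} {d' : Fin n' → (F.obj Y).Dual}
    (he : (F.obj X).IsDualBasis e e') (hd : (F.obj Y).IsDualBasis d d') (f : X ⟶ Y)
    (φ : (F.obj Y).Dual) (m : F.obj X) :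
    comulAt X e e' (RBimod.transpose (F.map f) φ ⊗ₜ[k] m) =
      comulAt Y d d' (φ ⊗ₜ[k] RBimod.toLin (F.map f) m) := by
  simp only [comulAt_tmul, clsLin_transpose]
  rw [sum_tsTmul_eq he hd φ m (RBimod.toLin (F.map f)) (RBimod.transpose (F.map f))
    (fun _ _ => rfl)]
  simp only [clsLin_transpose]

/-- The coproduct `Δ[φ ⊗ m] = ∑ [φ ⊗ e_i] ⊗ [e^i ⊗ m]`. -/
noncomputable def comul : Coend F →ₗ[k] TS (bimod F) (bimod F) :=
  lift (fun X => comulAt X (hF X).exists_isDualBasis.choose_spec.choose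
    (hF X).exists_isDualBasis.choose_spec.choose_spec.choose) fun X Y f φ m =>
    comulAt_transpose (hF X).exists_isDualBasis.choose_spec.choose_spec.choose_spec
      (hF Y).exists_isDualBasis.choose_spec.choose_spec.choose_spec f φ m

theorem comul_clsLin {X : C} {n : ℕ} {e : Fin n → F.obj X} {e' : Fin n → (F.obj X).Dual}
    (he : (F.obj X).IsDualBasis e e') (φ : (F.obj X).Dual) (m : F.obj X) :
    comul hF (clsLin F X φ m) = ∑ i, tsTmul F (clsLin F X φ (e i)) (clsLin F X (e' i) m) := by
  -- Naturality along $\mathrm{id}_X$ compares the dual bases chosen in the definition with the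
  -- given ones.
  have h := comulAt_transpose (hF X).exists_isDualBasis.choose_spec.choose_spec.choose_spec he
    (𝟙 X) φ m
  rw [RBimod.toLin_map_id, comulAt_tmul X e e'] at h
  rw [← h, ← cls_eq, comul, lift_cls]
  congr 2
  ext x
  exact congrArg φ (RBimod.toLin_map_id x).symm

theorem comul_clsLin_of_fintype {X : C} {ι : Type*} [Fintype ι] {e : ι → F.obj X}
    {e' : ι → (F.obj X).Dual} (he : ∀ x, x = ∑ i, op (e' i x) • e i) (φ : (F.obj X).Dual)
    (m : F.obj X) :
    comul hF (clsLin F X φ m) = ∑ i, tsTmul F (clsLin F X φ (e i)) (clsLin F X (e' i) m) := by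
  have h : (F.obj X).IsDualBasis (e ∘ (Fintype.equivFin ι).symm)
      (e' ∘ (Fintype.equivFin ι).symm) := fun x => by
    conv_lhs => rw [he x]
    exact ((Fintype.equivFin ι).symm.sum_comp fun i => op (e' i x) • e i).symm
  rw [comul_clsLin hF h]
  exact (Fintype.equivFin ι).symm.sum_comp fun i =>
    tsTmul F (clsLin F X φ (e i)) (clsLin F X (e' i) m)

theorem comul_isHom : (bimod F).IsHom ((bimod F).ts (bimod F)) (comul hF) where
  map_sl a := apply_eq_of_clsLin (comul hF ∘ₗ (bimod F).sl a)
    (((bimod F).ts (bimod F)).sl a ∘ₗ comul hF) fun X φ m => by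
      obtain ⟨n, e, e', he⟩ := (hF X).exists_isDualBasis
      simp [comul_clsLin hF he]
  map_sr a := apply_eq_of_clsLin (comul hF ∘ₗ (bimod F).sr a)
    (((bimod F).ts (bimod F)).sr a ∘ₗ comul hF) fun X φ m => by
      obtain ⟨n, e, e', he⟩ := (hF X).exists_isDualBasis
      simp [comul_clsLin hF he]
  map_tl a := apply_eq_of_clsLin (comul hF ∘ₗ (bimod F).tl a)
    (((bimod F).ts (bimod F)).tl a ∘ₗ comul hF) fun X φ m => by
      obtain ⟨n, e, e', he⟩ := (hF X).exists_isDualBasis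
      simp [comul_clsLin hF he]
  map_tr a := apply_eq_of_clsLin (comul hF ∘ₗ (bimod F).tr a)
    (((bimod F).ts (bimod F)).tr a ∘ₗ comul hF) fun X φ m => by
      obtain ⟨n, e, e', he⟩ := (hF X).exists_isDualBasis
      simp [comul_clsLin hF he]

variable (F) in
/-- The operators `x ⊗ y ↦ τ(a)x ⊗ y` on `L τ⊗σ L`. -/
noncomputable def tlTS : R →ₗ[k] Module.End k (TS (bimod F) (bimod F)) :=
  Bal.actL (bimod F).tl (fun a b h => (bimod F).tl_tr a b h)

variable (F) in
/-- The operators `x ⊗ y ↦ x ⊗ yσ(a)` on `L τ⊗σ L`. -/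
noncomputable def srTS : R →ₗ[k] Module.End k (TS (bimod F) (bimod F)) :=
  Bal.actR (bimod F).sr (fun a b h => ((bimod F).sl_sr b a h).symm)

@[simp] theorem tlTS_tsTmul (a : R) (x y : Coend F) :
    tlTS F a (tsTmul F x y) = tsTmul F ((bimod F).tl a x) y := rfl

@[simp] theorem srTS_tsTmul (a : R) (x y : Coend F) :
    srTS F a (tsTmul F x y) = tsTmul F x ((bimod F).sr a y) := rfl

/-- The image of `Δ` lies in the Takeuchi product: `∑ τ(a)h₁ ⊗ h₂ = ∑ h₁ ⊗ h₂σ(a)`. -/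
theorem tlTS_comul (a : R) (h : Coend F) :
    tlTS F a (comul hF h) = srTS F a (comul hF h) := by
  refine apply_eq_of_clsLin (tlTS F a ∘ₗ comul hF) (srTS F a ∘ₗ comul hF) (fun X φ m => ?_) h
  obtain ⟨n, e, e', he⟩ := (hF X).exists_isDualBasis
  -- Naturality of the canonical element under $x\mapsto ax$, which is right linear and has
  -- transpose $\psi\mapsto\psi a$.
  simpa [comul_clsLin hF he] using
    sum_tsTmul_eq he he φ m (a • ·) ((F.obj X).dualR a) (fun _ _ => rfl)

variable (F) in
/-- The counit `ε[φ ⊗ m] = φ(m)`. -/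
noncomputable def counit : Coend F →ₗ[k] R :=
  lift (fun X => TensorProduct.lift (LinearMap.mk₂ k (fun (φ : (F.obj X).Dual) m => φ m)
    (fun _ _ _ => rfl) (fun _ _ _ => rfl) (fun _ _ _ => map_add _ _ _)
    (fun c φ m => (F.obj X).dual_smul φ c m))) fun _ _ _ _ _ => rfl

@[simp] theorem counit_clsLin (X : C) (φ : (F.obj X).Dual) (m : F.obj X) :
    counit F (clsLin F X φ m) = φ m := lift_cls _ _ _ _ _

theorem counit_sl (a : R) (h : Coend F) : counit F ((bimod F).sl a h) = a * counit F h :=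
  apply_eq_of_clsLin (counit F ∘ₗ (bimod F).sl a) (LinearMap.mulLeft k a ∘ₗ counit F)
    (fun X φ m => by simp) h

theorem counit_tr (a : R) (h : Coend F) : counit F ((bimod F).tr a h) = counit F h * a :=
  apply_eq_of_clsLin (counit F ∘ₗ (bimod F).tr a) (LinearMap.mulRight k a ∘ₗ counit F)
    (fun X φ m => by simp) h

theorem counit_tl (a : R) (h : Coend F) :
    counit F ((bimod F).tl a h) = counit F ((bimod F).sr a h) :=
  apply_eq_of_clsLin (counit F ∘ₗ (bimod F).tl a) (counit F ∘ₗ (bimod F).sr a)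
    (fun X φ m => by simp) h

/-- The map `Δ ⊗ id` on `L τ⊗σ L`. -/
noncomputable def comulLeft :
    TS (bimod F) (bimod F) →ₗ[k] TS ((bimod F).ts (bimod F)) (bimod F) :=
  Bal.lift (mkTS ((bimod F).ts (bimod F)) (bimod F) ∘ₗ LinearMap.rTensor (Coend F) (comul hF))
    (fun a x y => by
      rw [LinearMap.comp_apply, LinearMap.comp_apply, LinearMap.rTensor_tmul,
        LinearMap.rTensor_tmul, (comul_isHom hF).map_tr]
      exact Bal.tmul_bal (f := fun a => ((bimod F).ts (bimod F)).tr a)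
        (g := fun a => (bimod F).sl a) a (comul hF x) y)

/-- The map `id ⊗ Δ` on `L τ⊗σ L`. -/
noncomputable def comulRight :
    TS (bimod F) (bimod F) →ₗ[k] TS (bimod F) ((bimod F).ts (bimod F)) :=
  Bal.lift (mkTS (bimod F) ((bimod F).ts (bimod F)) ∘ₗ LinearMap.lTensor (Coend F) (comul hF))
    (fun a x y => by
      rw [LinearMap.comp_apply, LinearMap.comp_apply, LinearMap.lTensor_tmul,
        LinearMap.lTensor_tmul, (comul_isHom hF).map_sl]
      exact Bal.tmul_bal (f := fun a => (bimod F).tr a)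
        (g := fun a => ((bimod F).ts (bimod F)).sl a) a x (comul hF y))

variable (F) in
/-- The bilinear map to `L τ⊗σ (L τ⊗σ L)`. -/
noncomputable def tsTmulTS : Coend F →ₗ[k] TS (bimod F) (bimod F) →ₗ[k]
    TS (bimod F) ((bimod F).ts (bimod F)) :=
  TensorProduct.curry (mkTS _ _)

variable (F) in
/-- The bilinear map to `(L τ⊗σ L) τ⊗σ L`. -/
noncomputable def tsTSTmul : TS (bimod F) (bimod F) →ₗ[k] Coend F →ₗ[k]
    TS ((bimod F).ts (bimod F)) (bimod F) :=
  TensorProduct.curry (mkTS _ _)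

theorem comulLeft_tsTmul (x y : Coend F) :
    comulLeft hF (tsTmul F x y) = tsTSTmul F (comul hF x) y := rfl

theorem comulRight_tsTmul (x y : Coend F) :
    comulRight hF (tsTmul F x y) = tsTmulTS F x (comul hF y) := rfl

theorem assocTS_tsTSTmul (x y z : Coend F) :
    assocTS (bimod F) (bimod F) (bimod F) (tsTSTmul F (tsTmul F x y) z) =
      tsTmulTS F x (tsTmul F y z) := rfl

theorem comul_coassoc (h : Coend F) :
    assocTS (bimod F) (bimod F) (bimod F) (comulLeft hF (comul hF h)) =
      comulRight hF (comul hF h) := by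
  refine apply_eq_of_clsLin (assocTS (bimod F) (bimod F) (bimod F) ∘ₗ comulLeft hF ∘ₗ comul hF)
    (comulRight hF ∘ₗ comul hF) (fun X φ m => ?_) h
  obtain ⟨n, e, e', he⟩ := (hF X).exists_isDualBasis
  simp only [LinearMap.comp_apply, comul_clsLin hF he, map_sum, comulLeft_tsTmul,
    comulRight_tsTmul, LinearMap.sum_apply, assocTS_tsTSTmul]
  -- Both sides are $\sum_{i,j}[\varphi\otimes e_i]\otimes[e^i\otimes e_j]\otimes[e^j\otimes m]$.
  exact Finset.sum_comm

variable (F) in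
/-- The map `x ⊗ y ↦ σ(ε(x))y` on `L τ⊗σ L`. -/
noncomputable def counitLeft : TS (bimod F) (bimod F) →ₗ[k] Coend F :=
  Bal.lift (TensorProduct.lift ((bimod F).sl ∘ₗ counit F))
    (fun a x y => by simp [counit_tr, (bimod F).sl_mul])

variable (F) in
/-- The map `x ⊗ y ↦ xτ(ε(y))` on `L τ⊗σ L`. -/
noncomputable def counitRight : TS (bimod F) (bimod F) →ₗ[k] Coend F :=
  Bal.lift (TensorProduct.lift ((bimod F).tr ∘ₗ counit F).flip)
    (fun a x y => by simp [counit_sl, (bimod F).tr_mul])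

theorem counitLeft_tsTmul (x y : Coend F) :
    counitLeft F (tsTmul F x y) = (bimod F).sl (counit F x) y := rfl

theorem counitRight_tsTmul (x y : Coend F) :
    counitRight F (tsTmul F x y) = (bimod F).tr (counit F y) x := rfl

/-- The two counit laws are the two forms of the dual basis identity: $\varphi=\sum\varphi(e_i)e^i$
here, and $m=\sum e_ie^i(m)$ for `counitRight_comul`. -/
theorem counitLeft_comul (h : Coend F) : counitLeft F (comul hF h) = h := by
  refine apply_eq_of_clsLin (counitLeft F ∘ₗ comul hF) LinearMap.id (fun X φ m => ?_) h
  obtain ⟨n, e, e', he⟩ := (hF X).exists_isDualBasis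
  simp only [LinearMap.comp_apply, comul_clsLin hF he, map_sum, counitLeft_tsTmul, bimod_sl,
    counit_clsLin, LinearMap.id_apply]
  conv_rhs => rw [← he.dual_eq φ, map_sum, LinearMap.sum_apply]

theorem counitRight_comul (h : Coend F) : counitRight F (comul hF h) = h := by
  refine apply_eq_of_clsLin (counitRight F ∘ₗ comul hF) LinearMap.id (fun X φ m => ?_) h
  obtain ⟨n, e, e', he⟩ := (hF X).exists_isDualBasis
  simp only [LinearMap.comp_apply, comul_clsLin hF he, map_sum, counitRight_tsTmul, bimod_tr,
    counit_clsLin, LinearMap.id_apply]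
  conv_rhs => rw [he m, map_sum]

/-- The coalgebroid structure on the coend. -/
noncomputable def coalgebroid : Coalgebroid (bimod F) where
  Δ := comul hF
  ε := counit F
  Δ_hom := comul_isHom hF
  coassoc h Z hZ := by
    have h₁ := comul_coassoc hF h
    rw [← hZ] at h₁
    exact h₁
  ε_lin a b h := by rw [counit_sl, counit_tr, mul_assoc]
  counit_left h Z hZ := (Bal.lift_of_mk_eq _ hZ).trans (counitLeft_comul hF h)
  counit_right h Z hZ := (Bal.lift_of_mk_eq _ hZ).trans (counitRight_comul hF h)
  ε_tl := counit_tl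

end Coend

end CoendSection

/-! ### The product, the unit and the bialgebroid -/

section Product

variable {k : Type u} {R : Type w} [CommRing k] [Ring R] [Algebra k R]
  {C : Type v₁} [Category.{v₂} C] {F : C ⥤ RBimod k R} [MonoidalCategory C]

namespace Coend

open DoubleBimod

variable (S : MonoidalStr F)

/-- The product of the summands at `X` and `Y`. -/
noncomputable def mulAt (X Y : C) : (F.obj X).Dual ⊗[k] F.obj X →ₗ[k]
    (F.obj Y).Dual ⊗[k] F.obj Y →ₗ[k] Coend F :=
  (TensorProduct.map₂ (S.dualMul X Y) (S.tmul X Y)).compr₂ (of F (X ⊗ Y))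

theorem mulAt_tmul (X Y : C) (φ : (F.obj X).Dual) (m : F.obj X) (ψ : (F.obj Y).Dual)
    (n : F.obj Y) : mulAt S X Y (φ ⊗ₜ[k] m) (ψ ⊗ₜ[k] n) =
      clsLin F (X ⊗ Y) (S.dualMul X Y φ ψ) (S.tmul X Y m n) := rfl

/-- By naturality of $\theta$ this is the coend relation along $f\otimes Y$; with its left-handed
companion it shows that the product descends to the coend in each variable. -/
theorem clsLin_tmul_whiskerRight {X X' Y : C} (f : X ⟶ X') (φ : (F.obj X').Dual) (m : F.obj X)
    (ψ : (F.obj Y).Dual) (n : F.obj Y) :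
    clsLin F (X ⊗ Y) (S.dualMul X Y (RBimod.transpose (F.map f) φ) ψ) (S.tmul X Y m n) =
      clsLin F (X' ⊗ Y) (S.dualMul X' Y φ ψ) (S.tmul X' Y (RBimod.toLin (F.map f) m) n) := by
  rw [← S.map_whiskerRight_tmul, ← clsLin_transpose]
  congr 2
  refine S.dual_ext fun x y => ?_
  simp [S.map_whiskerRight_tmul]

theorem clsLin_tmul_whiskerLeft {X Y Y' : C} (f : Y ⟶ Y') (φ : (F.obj X).Dual) (m : F.obj X)
    (ψ : (F.obj Y').Dual) (n : F.obj Y) :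
    clsLin F (X ⊗ Y) (S.dualMul X Y φ (RBimod.transpose (F.map f) ψ)) (S.tmul X Y m n) =
      clsLin F (X ⊗ Y') (S.dualMul X Y' φ ψ) (S.tmul X Y' m (RBimod.toLin (F.map f) n)) := by
  rw [← S.map_whiskerLeft_tmul, ← clsLin_transpose]
  congr 2
  refine S.dual_ext fun x y => ?_
  simp [S.map_whiskerLeft_tmul, RBimod.toLin_smul]

/-- Left multiplication by the elements of the summand at `X`. -/
noncomputable def mulLeft (X : C) :
    (F.obj X).Dual ⊗[k] F.obj X →ₗ[k] Coend F →ₗ[k] Coend F :=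
  TensorProduct.lift (LinearMap.mk₂ k
    (fun φ m => lift (fun Y => mulAt S X Y (φ ⊗ₜ[k] m)) fun Y Y' f ψ n => by
      simpa only [mulAt_tmul] using clsLin_tmul_whiskerLeft S f φ m ψ n)
    (fun φ φ' m => hom_ext fun Y ψ n => by
      simp only [lift_cls, LinearMap.add_apply, mulAt_tmul, map_add])
    (fun c φ m => hom_ext fun Y ψ n => by
      simp only [lift_cls, LinearMap.smul_apply, mulAt_tmul, map_smul])
    (fun φ m m' => hom_ext fun Y ψ n => by
      simp only [lift_cls, LinearMap.add_apply, mulAt_tmul, map_add])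
    (fun c φ m => hom_ext fun Y ψ n => by
      simp only [lift_cls, LinearMap.smul_apply, mulAt_tmul, map_smul]))

theorem mulLeft_tmul_clsLin (X Y : C) (φ : (F.obj X).Dual) (m : F.obj X) (ψ : (F.obj Y).Dual)
    (n : F.obj Y) : mulLeft S X (φ ⊗ₜ[k] m) (clsLin F Y ψ n) =
      clsLin F (X ⊗ Y) (S.dualMul X Y φ ψ) (S.tmul X Y m n) := by
  rw [mulLeft, TensorProduct.lift.tmul, LinearMap.mk₂_apply, ← cls_eq, lift_cls, mulAt_tmul]

/-- The product of the coend. -/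
noncomputable def mul : Coend F →ₗ[k] Coend F →ₗ[k] Coend F :=
  lift (mulLeft S) fun X X' f φ m => hom_ext_clsLin fun Y ψ n => by
    rw [mulLeft_tmul_clsLin, mulLeft_tmul_clsLin, clsLin_tmul_whiskerRight]

@[simp] theorem mul_clsLin (X Y : C) (φ : (F.obj X).Dual) (m : F.obj X) (ψ : (F.obj Y).Dual)
    (n : F.obj Y) : mul S (clsLin F X φ m) (clsLin F Y ψ n) =
      clsLin F (X ⊗ Y) (S.dualMul X Y φ ψ) (S.tmul X Y m n) := by
  rw [← cls_eq X, mul, lift_cls, mulLeft_tmul_clsLin]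

theorem mul_sl (a : R) (h g : Coend F) :
    mul S h ((bimod F).sl a g) = (bimod F).sl a (mul S h g) :=
  apply_eq_of_clsLin₂ ((mul S).compl₂ ((bimod F).sl a)) ((mul S).compr₂ ((bimod F).sl a))
    (fun X φ m Y ψ n => by simp [S.dualL_dualMul]) h g

theorem mul_tr (a : R) (h g : Coend F) :
    mul S h ((bimod F).tr a g) = (bimod F).tr a (mul S h g) :=
  apply_eq_of_clsLin₂ ((mul S).compl₂ ((bimod F).tr a)) ((mul S).compr₂ ((bimod F).tr a))
    (fun X φ m Y ψ n => by simp [S.op_smul_tmul]) h g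

theorem sr_mul (a : R) (h g : Coend F) :
    mul S ((bimod F).sr a h) g = (bimod F).sr a (mul S h g) :=
  apply_eq_of_clsLin₂ (mul S ∘ₗ (bimod F).sr a) ((mul S).compr₂ ((bimod F).sr a))
    (fun X φ m Y ψ n => by simp [S.dualMul_dualR]) h g

theorem tl_mul (a : R) (h g : Coend F) :
    mul S ((bimod F).tl a h) g = (bimod F).tl a (mul S h g) :=
  apply_eq_of_clsLin₂ (mul S ∘ₗ (bimod F).tl a) ((mul S).compr₂ ((bimod F).tl a))
    (fun X φ m Y ψ n => by simp [S.smul_tmul]) h g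

/-- Together with `tr_mul` this is the balance needed for the product to factor through $L\boxtimes
L$. -/
theorem sl_mul (a : R) (h g : Coend F) :
    mul S ((bimod F).sl a h) g = mul S h ((bimod F).sr a g) :=
  apply_eq_of_clsLin₂ (mul S ∘ₗ (bimod F).sl a) ((mul S).compl₂ ((bimod F).sr a))
    (fun X φ m Y ψ n => by simp [S.dualMul_dualL]) h g

theorem tr_mul (a : R) (h g : Coend F) :
    mul S ((bimod F).tr a h) g = mul S h ((bimod F).tl a g) :=
  apply_eq_of_clsLin₂ (mul S ∘ₗ (bimod F).tr a) ((mul S).compl₂ ((bimod F).tl a))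
    (fun X φ m Y ψ n => by simp [S.tmul_op_smul]) h g

theorem mul_assoc (x y z : Coend F) : mul S (mul S x y) z = mul S x (mul S y z) := by
  refine apply_eq_of_clsLin ((mul S).flip z ∘ₗ (mul S).flip y) ((mul S).flip (mul S y z))
    (fun X φ l => ?_) x
  refine apply_eq_of_clsLin₂ ((mul S) ∘ₗ (mul S (clsLin F X φ l)))
    ((mul S).compr₂ (mul S (clsLin F X φ l))) (fun Y ψ m Z χ n => ?_) y z
  rw [LinearMap.comp_apply, LinearMap.compr₂_apply, mul_clsLin, mul_clsLin, mul_clsLin,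
    mul_clsLin]
  -- The coend relation along the associator; on triple products both functionals take the value
  -- $\chi(\psi(\varphi(x)y)z)$.
  refine clsLin_eq (α_ X Y Z).hom (fun t => ?_) (S.map_associator_hom l m n)
  induction t using S.tmul_induction with
  | tmul t z =>
    induction t using S.tmul_induction with
    | tmul x y => simp [S.map_associator_hom, ← S.smul_tmul]
    | add x y hx hy => simp only [map_add, LinearMap.add_apply, hx, hy]
  | add x y hx hy => simp only [map_add, hx, hy]

/-- The product as a map on `L ⊠ L`. -/
noncomputable def boxMul : Box (bimod F) (bimod F) →ₗ[k] Coend F :=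
  Bal.lift (TensorProduct.lift (mul S)) (fun p h g => by
    simp [sl_mul, tr_mul])

theorem boxMul_isHom : ((bimod F).box (bimod F)).IsHom (bimod F) (boxMul S) where
  map_sl a z := by
    induction z using Bal.ind with
    | tmul h g => exact mul_sl S a h g
    | add x y hx hy => simp only [map_add, hx, hy]
  map_sr a z := by
    induction z using Bal.ind with
    | tmul h g => exact sr_mul S a h g
    | add x y hx hy => simp only [map_add, hx, hy]
  map_tl a z := by
    induction z using Bal.ind with
    | tmul h g => exact tl_mul S a h g
    | add x y hx hy => simp only [map_add, hx, hy]
  map_tr a z := by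
    induction z using Bal.ind with
    | tmul h g => exact mul_tr S a h g
    | add x y hx hy => simp only [map_add, hx, hy]

/-- The unit map `u(a ⊗ b) = [aη ⊗ η⁻¹(b)]`. -/
noncomputable def unit : R ⊗[k] R →ₗ[k] Coend F :=
  TensorProduct.lift
    ((clsLin F (𝟙_ C)).compl₁₂ ((F.obj (𝟙_ C)).dualL.flip S.counit) S.unit)

theorem unit_tmul (a b : R) : unit S (a ⊗ₜ[k] b) =
    clsLin F (𝟙_ C) ((F.obj (𝟙_ C)).dualL a S.counit) (S.unit b) := rfl

theorem unit_isHom : (DoubleBimod.unit k R).IsHom (bimod F) (unit S) where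
  map_sl a z := by
    induction z using TensorProduct.induction_on with
    | zero => simp only [map_zero]
    | tmul x y =>
      change unit S ((a * x) ⊗ₜ[k] y) = _
      rw [unit_tmul, unit_tmul, bimod_sl]
      congr 2
      ext e
      simp [_root_.mul_assoc]
    | add x y hx hy => simp only [map_add, hx, hy]
  map_sr a z := by
    induction z using TensorProduct.induction_on with
    | zero => simp only [map_zero]
    | tmul x y =>
      change unit S ((x * a) ⊗ₜ[k] y) = _
      rw [unit_tmul, unit_tmul, bimod_sr]
      congr 2
      ext e
      simp [_root_.mul_assoc, S.counit_smul]
    | add x y hx hy => simp only [map_add, hx, hy]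
  map_tl a z := by
    induction z using TensorProduct.induction_on with
    | zero => simp only [map_zero]
    | tmul x y =>
      change unit S (x ⊗ₜ[k] (a * y)) = _
      rw [unit_tmul, unit_tmul, bimod_tl, S.smul_unit]
    | add x y hx hy => simp only [map_add, hx, hy]
  map_tr a z := by
    induction z using TensorProduct.induction_on with
    | zero => simp only [map_zero]
    | tmul x y =>
      change unit S (x ⊗ₜ[k] (y * a)) = _
      rw [unit_tmul, unit_tmul, bimod_tr, S.op_smul_unit]
    | add x y hx hy => simp only [map_add, hx, hy]

/-- The coend relation along the right unitor; for `unit_mul` it is the left unitor. -/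
theorem mul_unit (h : Coend F) (a b : R) :
    mul S h (unit S (a ⊗ₜ[k] b)) = (bimod F).sl a ((bimod F).tr b h) := by
  refine apply_eq_of_clsLin ((mul S).flip (unit S (a ⊗ₜ[k] b)))
    ((bimod F).sl a ∘ₗ (bimod F).tr b) (fun X φ m => ?_) h
  rw [LinearMap.flip_apply, LinearMap.comp_apply, unit_tmul, mul_clsLin, bimod_tr, bimod_sl]
  refine clsLin_eq (ρ_ X).hom (fun z => ?_) (by simp [S.map_rightUnitor_tmul])
  induction z using S.tmul_induction with
  | tmul x e => simp [S.map_rightUnitor_tmul, S.counit_smul, _root_.mul_assoc]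
  | add x y hx hy => simp only [map_add, hx, hy]

theorem unit_mul (h : Coend F) (a b : R) :
    mul S (unit S (a ⊗ₜ[k] b)) h = (bimod F).tl b ((bimod F).sr a h) := by
  refine apply_eq_of_clsLin (mul S (unit S (a ⊗ₜ[k] b)))
    ((bimod F).tl b ∘ₗ (bimod F).sr a) (fun X φ m => ?_) h
  rw [LinearMap.comp_apply, unit_tmul, mul_clsLin, bimod_sr, bimod_tl]
  refine clsLin_eq (λ_ X).hom (fun z => ?_) (by simp [S.map_leftUnitor_tmul])
  induction z using S.tmul_induction with
  | tmul e x => simp [S.map_leftUnitor_tmul, mul_smul]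
  | add x y hx hy => simp only [map_add, hx, hy]

theorem counit_mul (h g : Coend F) :
    counit F (mul S h g) = counit F ((bimod F).sr (counit F h) g) :=
  apply_eq_of_clsLin₂ ((mul S).compr₂ (counit F)) (((bimod F).sr ∘ₗ counit F).compr₂ (counit F))
    (fun X φ m Y ψ n => by simp) h g

variable (hF : ∀ X, (F.obj X).IsLeftRigid)

/-- The operators `x ⊗ y ↦ h ∘ x ⊗ y` on `L τ⊗σ L`. -/
noncomputable def lmulTS : Coend F →ₗ[k] Module.End k (TS (bimod F) (bimod F)) :=
  Bal.actL (mul S) (fun h a x => mul_tr S a h x)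

/-- The operators `x ⊗ y ↦ x ⊗ h ∘ y` on `L τ⊗σ L`. -/
noncomputable def rmulTS : Coend F →ₗ[k] Module.End k (TS (bimod F) (bimod F)) :=
  Bal.actR (mul S) (fun h a x => mul_sl S a h x)

theorem lmulTS_tsTmul (h x y : Coend F) :
    lmulTS S h (tsTmul F x y) = tsTmul F (mul S h x) y := rfl

theorem rmulTS_tsTmul (h x y : Coend F) :
    rmulTS S h (tsTmul F x y) = tsTmul F x (mul S h y) := rfl

/-- With `rmulTS_sl`, this turns the balance of $x\otimes y\mapsto\sum x\circ g_1\otimes y\circ g_2$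
into the Takeuchi condition on $\Delta(g)$. -/
theorem lmulTS_tr (a : R) (h h' : Coend F) (z : TS (bimod F) (bimod F)) :
    lmulTS S ((bimod F).tr a h) (rmulTS S h' z) = lmulTS S h (rmulTS S h' (tlTS F a z)) := by
  refine LinearMap.congr_fun (f := lmulTS S ((bimod F).tr a h) ∘ₗ rmulTS S h')
    (g := lmulTS S h ∘ₗ rmulTS S h' ∘ₗ tlTS F a) (ts_hom_ext fun x y => ?_) z
  simp [lmulTS_tsTmul, rmulTS_tsTmul, tr_mul]

theorem rmulTS_sl (a : R) (h h' : Coend F) (z : TS (bimod F) (bimod F)) :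
    lmulTS S h (rmulTS S ((bimod F).sl a h') z) = lmulTS S h (rmulTS S h' (srTS F a z)) := by
  refine LinearMap.congr_fun (f := lmulTS S h ∘ₗ rmulTS S ((bimod F).sl a h'))
    (g := lmulTS S h ∘ₗ rmulTS S h' ∘ₗ srTS F a) (ts_hom_ext fun x y => ?_) z
  simp [lmulTS_tsTmul, rmulTS_tsTmul, sl_mul]

/-- The map `x ⊗ y ↦ ∑ x ∘ g₁ ⊗ y ∘ g₂` on `L τ⊗σ L`. -/
noncomputable def mulComul (g : Coend F) : Module.End k (TS (bimod F) (bimod F)) :=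
  Bal.lift (TensorProduct.lift ((LinearMap.mul k (Module.End k (TS (bimod F) (bimod F)))).compl₁₂
      (lmulTS S) (rmulTS S) |>.compr₂ (LinearMap.applyₗ (comul hF g)))) (fun a x y => by
    simp only [TensorProduct.lift.tmul, LinearMap.compr₂_apply, LinearMap.compl₁₂_apply,
      LinearMap.mul_apply', LinearMap.applyₗ_apply_apply, Module.End.mul_apply]
    rw [lmulTS_tr, rmulTS_sl, tlTS_comul])

theorem mulComul_tsTmul (g x y : Coend F) :
    mulComul S hF g (tsTmul F x y) = lmulTS S x (rmulTS S y (comul hF g)) := rfl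

theorem comul_mul (h g : Coend F) :
    comul hF (mul S h g) = mulComul S hF g (comul hF h) := by
  refine apply_eq_of_clsLin (comul hF ∘ₗ (mul S).flip g) (mulComul S hF g ∘ₗ comul hF)
    (fun X φ m => ?_) h
  obtain ⟨n, e, e', he⟩ := (hF X).exists_isDualBasis
  simp only [LinearMap.comp_apply, LinearMap.flip_apply, comul_clsLin hF he, map_sum,
    mulComul_tsTmul]
  have h₁ := apply_eq_of_clsLin (comul hF ∘ₗ mul S (clsLin F X φ m))
    (∑ i, lmulTS S (clsLin F X φ (e i)) ∘ₗ rmulTS S (clsLin F X (e' i) m) ∘ₗ comul hF)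
    (fun Y ψ p => ?_) g
  · rw [LinearMap.sum_apply] at h₁
    exact h₁
  obtain ⟨n', d, d', hd⟩ := (hF Y).exists_isDualBasis
  -- Here $\Delta$ at $X\otimes Y$ is computed with the products of the dual bases, indexed by
  -- pairs.
  rw [LinearMap.comp_apply, mul_clsLin, comul_clsLin_of_fintype hF
    (e := fun i : Fin n × Fin n' => S.tmul X Y (e i.1) (d i.2))
    (e' := fun i => S.dualMul X Y (e' i.1) (d' i.2))
    (fun x => by rw [Fintype.sum_prod_type]; exact S.isDualBasis_tmul he hd x),
    Fintype.sum_prod_type, LinearMap.sum_apply]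
  simp only [LinearMap.comp_apply, comul_clsLin hF hd, map_sum, rmulTS_tsTmul, lmulTS_tsTmul,
    mul_clsLin]

theorem map_mul_eq (H G : Coend F ⊗[k] Coend F) {g : Coend F}
    (hG : mkTS (bimod F) (bimod F) G = comul hF g) :
    mkTS (bimod F) (bimod F)
      (TensorProduct.map (boxMul S ∘ₗ mkBox (bimod F) (bimod F))
        (boxMul S ∘ₗ mkBox (bimod F) (bimod F))
        (TensorProduct.tensorTensorTensorComm k _ _ _ _ (H ⊗ₜ[k] G))) =
      mulComul S hF g (mkTS _ _ H) := by
  induction H using TensorProduct.induction_on with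
  | zero => simp only [TensorProduct.zero_tmul, map_zero]
  | add x y hx hy => simp only [TensorProduct.add_tmul, map_add, hx, hy]
  | tmul x y =>
    rw [mkTS_tmul, mulComul_tsTmul, ← hG]
    -- The remaining identity is additive in $G$ and no longer involves $g$, so $G$ need not
    -- represent a coproduct and induction applies.
    clear hG
    induction G using TensorProduct.induction_on with
    | zero => simp only [TensorProduct.tmul_zero, map_zero]
    | add x y hx hy => simp only [TensorProduct.tmul_add, map_add, hx, hy]
    | tmul x y => rfl

/-- The bialgebroid structure on the coend of a monoidal functor. -/
noncomputable def bialgebroid : Bialgebroid (bimod F) where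
  toCoalgebroid := coalgebroid hF
  m := boxMul S
  u := unit S
  m_hom := boxMul_isHom S
  u_hom := unit_isHom S
  Δ_m h g H G hH hG := by
    rw [map_mul_eq S hF H G hG, hH]
    exact comul_mul S hF h g
  ε_m := counit_mul S
  Δ_u a b := by
    refine (comul_clsLin hF S.isDualBasis_unit _ _).trans ?_
    rw [Fin.sum_univ_one, mkTS_tmul, unit_tmul, unit_tmul]
    congr 3
    ext e
    simp
  ε_u a b := (counit_clsLin _ _ _).trans (by simp)
  m_assoc := mul_assoc S
  m_u := mul_unit S
  u_m h a b := unit_mul S h a b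

end Coend

end Product

/-! ### Preservation of duals and the antipode -/

section Duality

variable {k : Type u} {R : Type w} [CommRing k] [Ring R] [Algebra k R]
  {C : Type v₁} [Category.{v₂} C] {F : C ⥤ RBimod k R} [MonoidalCategory C]

namespace MonoidalStr

variable (S : MonoidalStr F)

/-- The element `∑ x_i ⊗ y_i` of `F(X) ⊗ F(Y)` given by the coevaluation of an exact pairing, and
the triangle identities for it. -/
theorem exists_coevaluation_eq (X Y : C) [ExactPairing X Y] :
    ∃ (n : ℕ) (x : Fin n → F.obj X) (y : Fin n → F.obj Y),
      RBimod.toLin (F.map (η_ X Y)) (S.unit 1) = ∑ i, S.tmul X Y (x i) (y i) ∧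
      (∀ ξ, ∑ i, S.pairingLin (ε_ X Y) ξ (x i) • y i = ξ) ∧
      (F.obj X).IsDualBasis x fun i => S.pairingLin (ε_ X Y) (y i) := by
  obtain ⟨n, x, y, h⟩ := S.exists_eq_sum_tmul (RBimod.toLin (F.map (η_ X Y)) (S.unit 1))
  refine ⟨n, x, y, h, fun ξ => ?_, fun m => ?_⟩
  -- One triangle identity, evaluated at $\theta(\xi\otimes\eta^{-1}(1))$; the other, at
  -- $\theta(\eta^{-1}(1)\otimes m)$, gives the dual bases.
  · have h₁ := congrArg (fun f => RBimod.toLin (F.map (λ_ Y).hom)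
      (RBimod.toLin (F.map f) (S.tmul Y (𝟙_ C) ξ (S.unit 1))))
      (ExactPairing.coevaluation_evaluation X Y)
    simp only [← RBimod.toLin_map_comp, Category.assoc, Iso.inv_hom_id, Category.comp_id] at h₁
    simpa only [RBimod.toLin_map_comp, S.map_whiskerLeft_tmul, h, S.map_associator_inv,
      S.map_whiskerRight_tmul, S.map_leftUnitor_tmul, S.map_rightUnitor_tmul, map_sum,
      S.counit_unit, op_one, one_smul, ← S.pairingLin_apply] using h₁
  · have h₁ := congrArg (fun f => RBimod.toLin (F.map (ρ_ X).hom)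
      (RBimod.toLin (F.map f) (S.tmul (𝟙_ C) X (S.unit 1) m)))
      (ExactPairing.evaluation_coevaluation X Y)
    simp only [← RBimod.toLin_map_comp, Category.assoc, Iso.inv_hom_id, Category.comp_id] at h₁
    simpa only [RBimod.toLin_map_comp, S.map_whiskerLeft_tmul, h, S.map_associator_hom,
      S.map_whiskerRight_tmul, S.map_leftUnitor_tmul, S.map_rightUnitor_tmul, map_sum,
      LinearMap.sum_apply, S.counit_unit, one_smul, ← S.pairingLin_apply] using h₁.symm

/-- The functor preserves duals: `F(Y)` is identified with `F(X)^*` if `Y` is a left dual of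
`X`. -/
noncomputable def pairingEquiv (X Y : C) [ExactPairing X Y] : F.obj Y ≃ₗ[k] (F.obj X).Dual :=
  LinearEquiv.ofBijective (S.pairingLin (ε_ X Y)) (by
    obtain ⟨n, x, y, -, h₁, h₂⟩ := S.exists_coevaluation_eq X Y
    -- The inverse is $\varphi\mapsto\sum\varphi(x_i)y_i$.
    refine ⟨fun ξ ξ' h => by rw [← h₁ ξ, ← h₁ ξ', h], fun φ => ⟨∑ i, φ (x i) • y i, ?_⟩⟩
    rw [map_sum]
    simp only [S.pairingLin_smul]
    exact h₂.dual_eq φ)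

@[simp] theorem pairingEquiv_apply (X Y : C) [ExactPairing X Y] (ξ : F.obj Y) :
    S.pairingEquiv X Y ξ = S.pairingLin (ε_ X Y) ξ := rfl

theorem pairingEquiv_symm_dualL (X Y : C) [ExactPairing X Y] (a : R) (φ : (F.obj X).Dual) :
    (S.pairingEquiv X Y).symm ((F.obj X).dualL a φ) = a • (S.pairingEquiv X Y).symm φ := by
  rw [LinearEquiv.symm_apply_eq, pairingEquiv_apply, pairingLin_smul, ← pairingEquiv_apply,
    LinearEquiv.apply_symm_apply]

/-- The transpose of `f : X ⟶ X'` with respect to left duals `Y`, `Y'`. -/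
theorem exists_left_transpose {X X' : C} (Y Y' : C) [ExactPairing X Y] [ExactPairing X' Y']
    (f : X ⟶ X') : ∃ g : Y' ⟶ Y, ∀ ξ : F.obj Y',
      S.pairingLin (ε_ X Y) (RBimod.toLin (F.map g) ξ) =
        RBimod.transpose (F.map f) (S.pairingLin (ε_ X' Y') ξ) := by
  obtain ⟨g, h⟩ : ∃ g : Y' ⟶ Y, g ▷ X ≫ ε_ X Y = Y' ◁ f ≫ ε_ X' Y' :=
    -- The naming conventions are opposite: the left dual $X^*$ of the theorem is the right dual of
    -- `HasRightDual`.
    let _ : HasRightDual X := ⟨Y⟩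
    let _ : HasRightDual X' := ⟨Y'⟩
    ⟨rightAdjointMate f, rightAdjointMate_comp_evaluation f⟩
  refine ⟨g, fun ξ => ?_⟩
  ext m
  have h₁ := congrArg (fun g => S.counit (RBimod.toLin (F.map g) (S.tmul Y' X ξ m))) h
  simpa only [RBimod.toLin_map_comp, S.map_whiskerLeft_tmul, S.map_whiskerRight_tmul,
    ← S.pairingLin_apply, ← RBimod.transpose_apply] using h₁

/-- The transpose of `f : X ⟶ X'` with respect to right duals `Y`, `Y'`. -/
theorem exists_right_transpose {X X' : C} (Y Y' : C) [ExactPairing Y X] [ExactPairing Y' X']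
    (f : X ⟶ X') : ∃ g : Y' ⟶ Y, ∀ m : F.obj X,
      S.pairingLin (ε_ Y' X') (RBimod.toLin (F.map f) m) =
        RBimod.transpose (F.map g) (S.pairingLin (ε_ Y X) m) := by
  obtain ⟨g, h⟩ : ∃ g : Y' ⟶ Y, X ◁ g ≫ ε_ Y X = f ▷ Y' ≫ ε_ Y' X' :=
    let _ : HasLeftDual X := ⟨Y⟩
    let _ : HasLeftDual X' := ⟨Y'⟩
    ⟨leftAdjointMate f, leftAdjointMate_comp_evaluation f⟩
  refine ⟨g, fun m => ?_⟩
  ext y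
  have h₁ := congrArg (fun g => S.counit (RBimod.toLin (F.map g) (S.tmul X Y' m y))) h
  simpa only [RBimod.toLin_map_comp, S.map_whiskerLeft_tmul, S.map_whiskerRight_tmul,
    ← S.pairingLin_apply, ← RBimod.transpose_apply]
    using h₁.symm

/-- At $\theta(y\otimes x)$ the sum is $\sum\hat e_j(e^j(y)x)$, which is $\hat y(x)$ because $y=\sum
e_je^j(y)$. The functional is thus pulled back along $\mathrm{ev}$, so the coend relation applies to
it. -/
theorem sum_dualMul_pairing {X Y : C} (ev : Y ⊗ X ⟶ 𝟙_ C) {n : ℕ} {e : Fin n → F.obj Y}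
    {e' : Fin n → (F.obj Y).Dual} (he : (F.obj Y).IsDualBasis e e') :
    ∑ j, S.dualMul Y X (e' j) (S.pairingLin ev (e j)) =
      RBimod.transpose (F.map ev) S.counit := by
  refine S.dual_ext fun y x => ?_
  rw [RBimod.transpose_apply, ← S.pairingLin_apply]
  conv_rhs => rw [he y]
  simp only [LinearMap.sum_apply, map_sum, S.pairingLin_op_smul, RBimod.dualR_apply,
    dualMul_tmul]

end MonoidalStr

namespace Coend

open DoubleBimod

variable (S : MonoidalStr F)

/-- The unit element `1 = u(1 ⊗ 1)`. -/
noncomputable def one : Coend F := unit S (1 ⊗ₜ[k] 1)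

/-- As $F(I)\cong R$, both $\varphi$ and $e$ are multiples of the generators $\eta$ and
$\eta^{-1}(1)$. The next two lemmas combine this with a coend relation into or out of $I$; they
serve $\mathrm{ev}$ and $\mathrm{db}$ respectively. -/
theorem clsLin_unit (φ : (F.obj (𝟙_ C)).Dual) (e : F.obj (𝟙_ C)) :
    clsLin F (𝟙_ C) φ e =
      (bimod F).sl (φ (S.unit 1)) ((bimod F).tr (S.counit e) (one S)) := by
  rw [one, unit_tmul, bimod_tr, bimod_sl, S.op_smul_unit, one_mul, S.unit_counit]
  congr 2
  ext x
  conv_lhs => rw [S.isDualBasis_unit x]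
  simp

theorem clsLin_transpose_counit {X : C} (f : X ⟶ 𝟙_ C) (x : F.obj X) :
    clsLin F X (RBimod.transpose (F.map f) S.counit) x =
      (bimod F).tr (S.counit (RBimod.toLin (F.map f) x)) (one S) := by
  rw [clsLin_transpose, clsLin_unit S, S.counit_unit, (bimod F).sl_one]

theorem clsLin_map_unit {X : C} (f : 𝟙_ C ⟶ X) (φ : (F.obj X).Dual) :
    clsLin F X φ (RBimod.toLin (F.map f) (S.unit 1)) =
      (bimod F).sl (φ (RBimod.toLin (F.map f) (S.unit 1))) (one S) := by
  rw [← clsLin_transpose, clsLin_unit S, S.counit_unit, (bimod F).tr_one, RBimod.transpose_apply]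

variable (hF : ∀ X, (F.obj X).IsLeftRigid)

theorem bialgebroid_mulTSl : (bialgebroid S hF).mulTSl = lmulTS S :=
  LinearMap.ext fun _ => ts_hom_ext fun _ _ => rfl

theorem bialgebroid_mulTSr : (bialgebroid S hF).mulTSr = rmulTS S :=
  LinearMap.ext fun _ => ts_hom_ext fun _ _ => rfl

/-! #### The antipode -/

/-- The operators `x ⊗ y ↦ h ∘ x ⊗ y` on `L σ⊗σ L`. -/
noncomputable def lmulSS : Coend F →ₗ[k] Module.End k (SS (bimod F) (bimod F)) :=
  Bal.actL (mul S) (fun h a x => mul_sl S a h x)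

theorem lmulSS_ssTmul (h x y : Coend F) :
    lmulSS S h (ssTmul F x y) = ssTmul F (mul S h x) y := rfl

theorem lmulSS_tr (a : R) (h : Coend F) (z : SS (bimod F) (bimod F)) :
    lmulSS S ((bimod F).tr a h) z = lmulSS S h (tlSS F a z) := by
  refine LinearMap.congr_fun (f := lmulSS S ((bimod F).tr a h))
    (g := lmulSS S h ∘ₗ tlSS F a) (Bal.hom_ext fun x y => ?_) z
  change ssTmul F _ y = ssTmul F _ y
  rw [tr_mul]

theorem bialgebroid_mulSS : (bialgebroid S hF).mulSS = lmulSS S :=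
  LinearMap.ext fun _ => Bal.hom_ext fun _ _ => rfl

theorem lmulTS_sl (a : R) (h : Coend F) (z : TS (bimod F) (bimod F)) :
    lmulTS S ((bimod F).sl a h) z = lmulTS S h (((bimod F).ts (bimod F)).sr a z) := by
  refine LinearMap.congr_fun (f := lmulTS S ((bimod F).sl a h))
    (g := lmulTS S h ∘ₗ ((bimod F).ts (bimod F)).sr a) (ts_hom_ext fun x y => ?_) z
  simp [lmulTS_tsTmul, sl_mul]

theorem rmulTS_tr (a : R) (h : Coend F) (z : TS (bimod F) (bimod F)) :
    rmulTS S ((bimod F).tr a h) z = rmulTS S h (((bimod F).ts (bimod F)).tl a z) := by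
  refine LinearMap.congr_fun (f := rmulTS S ((bimod F).tr a h))
    (g := rmulTS S h ∘ₗ ((bimod F).ts (bimod F)).tl a) (ts_hom_ext fun x y => ?_) z
  simp [rmulTS_tsTmul, tr_mul]

theorem sum_ssTmul_eq {X X' Y Y' : C} [ExactPairing X Y] [ExactPairing X' Y'] {n n' : ℕ}
    {e : Fin n → F.obj Y} {e' : Fin n → (F.obj Y).Dual} {d : Fin n' → F.obj Y'}
    {d' : Fin n' → (F.obj Y').Dual} (he : (F.obj Y).IsDualBasis e e')
    (hd : (F.obj Y').IsDualBasis d d') (f : X ⟶ X') {ξ : F.obj Y} {ξ' : F.obj Y'}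
    (hξ : S.pairingLin (ε_ X Y) ξ =
      RBimod.transpose (F.map f) (S.pairingLin (ε_ X' Y') ξ')) (m : F.obj X) :
    ∑ j, ssTmul F (clsLin F Y (e' j) ξ) (clsLin F X (S.pairingLin (ε_ X Y) (e j)) m) =
      ∑ j, ssTmul F (clsLin F Y' (d' j) ξ')
        (clsLin F X' (S.pairingLin (ε_ X' Y') (d j)) (RBimod.toLin (F.map f) m)) := by
  obtain ⟨g, hg⟩ := S.exists_left_transpose Y Y' f
  obtain rfl : ξ = RBimod.toLin (F.map g) ξ' :=
    (S.pairingEquiv X Y).injective (hξ.trans (hg ξ').symm)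
  -- With $g:Y'\to Y$ the transpose of $f$, coend relations along $g$ and $f$ bring both sides to
  -- classes at $Y'$ and $X$; what remains is naturality of the canonical element under $F(g)$.
  simp only [← clsLin_transpose, ← hg]
  exact (hd.sum_eq he (((ssTmul F).compl₁₂ ((clsLin F Y').flip ξ')
    ((clsLin F X).flip m ∘ₗ S.pairingLin (ε_ X Y))).flip) (fun a x φ => by
      simp only [LinearMap.compl₁₂_apply, LinearMap.flip_apply, LinearMap.comp_apply,
        S.pairingLin_op_smul]
      rw [← bimod_sr, ← ssTmul_sl, bimod_sl]) (RBimod.toLin (F.map g))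
      (RBimod.transpose (F.map g)) (fun _ _ => rfl)).symm

/-- The formula for the antipode of the coend. -/
def IsNabla (N : Coend F →ₗ[k] SS (bimod F) (bimod F)) : Prop :=
  ∀ (X Y : C) [ExactPairing X Y] (ξ : F.obj Y) (m : F.obj X) (n : ℕ)
    (e : Fin n → F.obj Y) (e' : Fin n → (F.obj Y).Dual), (F.obj Y).IsDualBasis e e' →
    N (clsLin F X (S.pairingLin (ε_ X Y) ξ) m) = ∑ j, ssTmul F (clsLin F Y (e' j) ξ)
      (clsLin F X (S.pairingLin (ε_ X Y) (e j)) m)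

include hF in
theorem exists_isNabla (hC : IsLeftRigidCat C) : ∃ N, IsNabla S N := by
  choose Y hY using hC
  let _ (X : C) : ExactPairing X (Y X) := (hY X).some
  choose n e e' he using fun X => (hF (Y X)).exists_isDualBasis
  let δ (X : C) : (F.obj X).Dual ⊗[k] F.obj X →ₗ[k] SS (bimod F) (bimod F) :=
    TensorProduct.lift (∑ j, (ssTmul F).compl₁₂
      (clsLin F (Y X) (e' X j) ∘ₗ (S.pairingEquiv X (Y X)).symm.toLinearMap)
      (clsLin F X (S.pairingLin (ε_ X (Y X)) (e X j))))
  have hδ (X : C) (φ : (F.obj X).Dual) (m : F.obj X) : δ X (φ ⊗ₜ[k] m) =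
      ∑ j, ssTmul F (clsLin F (Y X) (e' X j) ((S.pairingEquiv X (Y X)).symm φ))
        (clsLin F X (S.pairingLin (ε_ X (Y X)) (e X j)) m) := by
    simp [δ, LinearMap.sum_apply]
  have hξ (X : C) (φ : (F.obj X).Dual) :
      S.pairingLin (ε_ X (Y X)) ((S.pairingEquiv X (Y X)).symm φ) = φ :=
    (S.pairingEquiv X (Y X)).apply_symm_apply φ
  refine ⟨lift δ fun X X' f φ m => ?_, fun X Z _ ξ m l d d' hd => ?_⟩
  · rw [hδ, hδ]
    exact sum_ssTmul_eq S (he X) (he X') f (by rw [hξ, hξ]) m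
  · rw [← cls_eq, lift_cls, hδ]
    -- Naturality along $\mathrm{id}_X$ compares the chosen dual and its bases with an arbitrary
    -- dual $Z$ and its bases.
    have h := sum_ssTmul_eq S (he X) hd (𝟙 X) (ξ := (S.pairingEquiv X (Y X)).symm
      (S.pairingLin (ε_ X Z) ξ)) (ξ' := ξ) (by
        rw [hξ]
        ext x
        exact congrArg _ (RBimod.toLin_map_id x).symm) m
    rwa [RBimod.toLin_map_id] at h

variable {S} {N : Coend F →ₗ[k] SS (bimod F) (bimod F)} (hC : IsLeftRigidCat C)

include hC in
-- Since $a\hat\xi=\widehat{a\xi}$, the action $\sigma(a)$ on the argument becomes $\tau(a)$ on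
-- $h^-$. This makes $x\otimes y\mapsto\sum x\circ y^-\otimes y^+$ balanced over
-- $L\,{}_\tau\!\otimes^\sigma L$.
theorem IsNabla.map_sl (hN : IsNabla S N) (hF : ∀ X, (F.obj X).IsLeftRigid) (a : R)
    (h : Coend F) : N ((bimod F).sl a h) = tlSS F a (N h) := by
  refine apply_eq_of_clsLin (N ∘ₗ (bimod F).sl a) (tlSS F a ∘ₗ N) (fun X φ m => ?_) h
  obtain ⟨Y, ⟨_⟩⟩ := hC X
  obtain ⟨n, e, e', he⟩ := (hF Y).exists_isDualBasis
  obtain ⟨ξ, rfl⟩ := (S.pairingEquiv X Y).surjective φ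
  rw [LinearMap.comp_apply, LinearMap.comp_apply, bimod_sl, S.pairingEquiv_apply,
    ← S.pairingLin_smul, hN X Y _ m n e e' he, hN X Y _ m n e e' he, map_sum]
  simp only [tlSS_ssTmul, bimod_tl]

include hC in
theorem IsNabla.lmulTS_comul (hN : IsNabla S N) {h : Coend F} {Z : Coend F ⊗[k] Coend F}
    (hZ : mkSS (bimod F) (bimod F) Z = N h) :
    TensorProduct.lift ((lmulTS S).compl₂ (comul hF)) Z = tsTmul F (one S) h := by
  have hφ (a : R) (x y : Coend F) :
      TensorProduct.lift ((lmulTS S).compl₂ (comul hF)) ((bimod F).sl a x ⊗ₜ[k] y) =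
        TensorProduct.lift ((lmulTS S).compl₂ (comul hF)) (x ⊗ₜ[k] (bimod F).sr a y) := by
    simp only [TensorProduct.lift.tmul, LinearMap.compl₂_apply]
    rw [lmulTS_sl, (comul_isHom hF).map_sr]
  have hT (x y : Coend F) : Bal.lift _ hφ (ssTmul F x y) = lmulTS S x (comul hF y) :=
    (Bal.lift_tmul _ hφ x y).trans (TensorProduct.lift.tmul x y)
  rw [Bal.lift_of_mk_eq hφ hZ]
  generalize Bal.lift _ hφ = T at hT
  refine apply_eq_of_clsLin (T ∘ₗ N) (tsTmul F (one S)) (fun X φ m => ?_) h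
  obtain ⟨Y, ⟨_⟩⟩ := hC X
  obtain ⟨n, e, e', he⟩ := (hF Y).exists_isDualBasis
  obtain ⟨l, b, b', hb⟩ := (hF X).exists_isDualBasis
  obtain ⟨ξ, rfl⟩ := (S.pairingEquiv X Y).surjective φ
  rw [LinearMap.comp_apply, S.pairingEquiv_apply, hN X Y _ m n e e' he]
  simp only [map_sum, hT, comul_clsLin hF hb, lmulTS_tsTmul, mul_clsLin]
  rw [Finset.sum_comm]
  conv_rhs => rw [← hb.dual_eq (S.pairingLin (ε_ X Y) ξ)]
  simp only [map_sum, LinearMap.sum_apply]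
  refine Finset.sum_congr rfl fun i _ => ?_
  -- For fixed $i$, the sum over $j$ of the products is a class with functional $\eta
  -- F(\mathrm{ev})$; it collapses to $1\,\tau(\hat\xi(b_i))$, and the scalar crosses to $b^i$ to
  -- rebuild $\hat\xi$.
  rw [← bimod_sl, ← tsTmul_tr, S.pairingLin_apply, ← clsLin_transpose_counit,
    ← S.sum_dualMul_pairing _ he]
  simp only [map_sum, LinearMap.sum_apply]

include hC in
theorem IsNabla.lmulSS_nabla (hN : IsNabla S N) {h : Coend F} {Z : Coend F ⊗[k] Coend F}
    (hZ : mkTS (bimod F) (bimod F) Z = comul hF h) :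
    TensorProduct.lift ((lmulSS S).compl₂ N) Z = ssTmul F (one S) h := by
  have hφ (a : R) (x y : Coend F) :
      TensorProduct.lift ((lmulSS S).compl₂ N) ((bimod F).tr a x ⊗ₜ[k] y) =
        TensorProduct.lift ((lmulSS S).compl₂ N) (x ⊗ₜ[k] (bimod F).sl a y) := by
    simp only [TensorProduct.lift.tmul, LinearMap.compl₂_apply]
    rw [lmulSS_tr, hN.map_sl hC hF]
  have hT (x y : Coend F) : Bal.lift _ hφ (tsTmul F x y) = lmulSS S x (N y) :=
    (Bal.lift_tmul _ hφ x y).trans (TensorProduct.lift.tmul x y)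
  rw [Bal.lift_of_mk_eq hφ hZ]
  generalize Bal.lift _ hφ = T at hT
  refine apply_eq_of_clsLin (T ∘ₗ comul hF) (ssTmul F (one S)) (fun X φ m => ?_) h
  obtain ⟨Y, ⟨_⟩⟩ := hC X
  obtain ⟨n, e, e', he⟩ := (hF Y).exists_isDualBasis
  obtain ⟨l, x, y, hxy, h₁, h₂⟩ := S.exists_coevaluation_eq X Y
  obtain ⟨ξ, rfl⟩ := (S.pairingEquiv X Y).surjective φ
  -- Here $\Delta$ is computed with the dual bases $x_i,\hat y_i$ coming from $\mathrm{db}$, so that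
  -- the formula for `N` applies to each $[\hat y_i\otimes m]$ and the products contain
  -- $\sum\theta(x_i\otimes y_i)=F(\mathrm{db})\eta^{-1}(1)$.
  rw [LinearMap.comp_apply, S.pairingEquiv_apply, comul_clsLin hF h₂]
  simp only [map_sum, hT, hN X Y _ m n e e' he, lmulSS_ssTmul, mul_clsLin]
  rw [Finset.sum_comm]
  conv_rhs => rw [he ξ]
  simp only [map_sum, LinearMap.sum_apply]
  refine Finset.sum_congr rfl fun j _ => ?_
  rw [S.pairingLin_op_smul, ← bimod_sr, ← ssTmul_sl]
  -- The scalar left by the collapse along $\mathrm{db}$ is $\sum_i e^j(\hat\xi(x_i)y_i)=e^j(\xi)$.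
  have h₃ : S.dualMul X Y (S.pairingLin (ε_ X Y) ξ) (e' j)
      (RBimod.toLin (F.map (η_ X Y)) (S.unit 1)) = e' j ξ := by
    simp only [hxy, map_sum, S.dualMul_tmul]
    rw [← map_sum, h₁]
  rw [← h₃, ← clsLin_map_unit, hxy]
  simp only [map_sum, LinearMap.sum_apply]

/-- The antipode on the coend. -/
noncomputable def antipode (hN : IsNabla S N) : (bialgebroid S hF).Antipode where
  nabla := N
  nabla_Δ h Z hZ := by
    rw [bialgebroid_mulTSl]
    exact hN.lmulTS_comul hF hC hZ
  Δ_nabla h Z hZ := by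
    rw [bialgebroid_mulSS]
    exact hN.lmulSS_nabla hF hC hZ

end Coend

end Duality

/-! ### The opposite antipode -/

section OppositeAntipode

variable {k : Type u} {R : Type w} [CommRing k] [Ring R] [Algebra k R]
  {C : Type v₁} [Category.{v₂} C] {F : C ⥤ RBimod k R} [MonoidalCategory C]

namespace Coend

open DoubleBimod

variable (S : MonoidalStr F) (hF : ∀ X, (F.obj X).IsLeftRigid)

/-- The operators `x ⊗ y ↦ h ∘ x ⊗ y` on `L τ⊗τ L`. -/
noncomputable def lmulTT : Coend F →ₗ[k] Module.End k (TT (bimod F) (bimod F)) :=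
  Bal.actL (mul S) (fun h a x => mul_tr S a h x)

theorem lmulTT_ttTmul (h x y : Coend F) :
    lmulTT S h (ttTmul F x y) = ttTmul F (mul S h x) y := rfl

theorem lmulTT_sl (a : R) (h : Coend F) (z : TT (bimod F) (bimod F)) :
    lmulTT S ((bimod F).sl a h) z = lmulTT S h (srTT F a z) := by
  refine LinearMap.congr_fun (f := lmulTT S ((bimod F).sl a h))
    (g := lmulTT S h ∘ₗ srTT F a) (Bal.hom_ext fun x y => ?_) z
  change ttTmul F _ y = ttTmul F _ y
  rw [sl_mul]

theorem bialgebroid_mulTT : (bialgebroid S hF).mulTT = lmulTT S :=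
  LinearMap.ext fun _ => Bal.hom_ext fun _ _ => rfl

theorem sum_ttTmul_eq {X X' Y Y' : C} [ExactPairing Y X] [ExactPairing Y' X'] {n n' : ℕ}
    {f : Fin n → F.obj Y} {g : Fin n → F.obj X} {f' : Fin n' → F.obj Y'} {g' : Fin n' → F.obj X'}
    (h : (F.obj Y).IsDualBasis f fun j => S.pairingLin (ε_ Y X) (g j))
    (h' : (F.obj Y').IsDualBasis f' fun j => S.pairingLin (ε_ Y' X') (g' j)) (t : X ⟶ X')
    (φ : (F.obj X').Dual) (m : F.obj X) :
    ∑ j, ttTmul F (clsLin F Y (S.pairingLin (ε_ Y X) m) (f j))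
        (clsLin F X (RBimod.transpose (F.map t) φ) (g j)) =
      ∑ j, ttTmul F (clsLin F Y' (S.pairingLin (ε_ Y' X') (RBimod.toLin (F.map t) m)) (f' j))
        (clsLin F X' φ (g' j)) := by
  obtain ⟨s, hs⟩ := S.exists_right_transpose Y Y' t
  simp only [clsLin_transpose, hs]
  -- Naturality of the canonical element under $F(s)$, with $s:Y'\to Y$ the transpose of $t$. A
  -- functional on $F(Y')$ is read as an element of $F(X')$ through the inverse of $m\mapsto\hat m$.
  have h₁ := h'.sum_eq h ((ttTmul F).compl₁₂ (clsLin F Y (S.pairingLin (ε_ Y X) m))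
    (clsLin F X' φ ∘ₗ (S.pairingEquiv Y' X').symm.toLinearMap)) (fun a x ψ => by
      simp only [LinearMap.compl₁₂_apply, LinearMap.comp_apply, LinearEquiv.coe_coe,
        S.pairingEquiv_symm_dualL]
      rw [← bimod_tr, ttTmul_tr, bimod_tl]) (RBimod.toLin (F.map s))
      (RBimod.transpose (F.map s)) (fun _ _ => rfl)
  simp only [← hs, ← S.pairingEquiv_apply Y' X', LinearMap.compl₁₂_apply, LinearMap.comp_apply,
    LinearEquiv.coe_coe, LinearEquiv.symm_apply_apply] at h₁
  exact h₁.symm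

/-- The formula for the opposite antipode of the coend. -/
def IsOppNabla (N : Coend F →ₗ[k] TT (bimod F) (bimod F)) : Prop :=
  ∀ (X Y : C) [ExactPairing Y X] (φ : (F.obj X).Dual) (m : F.obj X) (n : ℕ)
    (f : Fin n → F.obj Y) (g : Fin n → F.obj X),
    (F.obj Y).IsDualBasis f (fun j => S.pairingLin (ε_ Y X) (g j)) →
    N (clsLin F X φ m) = ∑ j, ttTmul F (clsLin F Y (S.pairingLin (ε_ Y X) m) (f j))
      (clsLin F X φ (g j))

theorem exists_isOppNabla (hC : IsRightRigidCat C) : ∃ N, IsOppNabla S N := by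
  choose Y hY using hC
  let _ (X : C) : ExactPairing (Y X) X := (hY X).some
  -- The components of $F(\mathrm{db})\eta^{-1}(1)$ supply $f_j$ and $g_j$ for which $f_j,\hat g_j$
  -- are dual bases.
  choose n f g _ _ h using fun X => S.exists_coevaluation_eq (Y X) X
  let δ (X : C) : (F.obj X).Dual ⊗[k] F.obj X →ₗ[k] TT (bimod F) (bimod F) :=
    TensorProduct.lift (∑ j, ((ttTmul F).compl₁₂
      ((clsLin F (Y X)).flip (f X j) ∘ₗ S.pairingLin (ε_ (Y X) X))
      ((clsLin F X).flip (g X j))).flip)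
  have hδ (X : C) (φ : (F.obj X).Dual) (m : F.obj X) : δ X (φ ⊗ₜ[k] m) =
      ∑ j, ttTmul F (clsLin F (Y X) (S.pairingLin (ε_ (Y X) X) m) (f X j))
        (clsLin F X φ (g X j)) := by
    simp [δ, LinearMap.sum_apply]
  refine ⟨lift δ fun X X' t φ m => ?_, fun X Z _ φ m l f' g' h' => ?_⟩
  · rw [hδ, hδ]
    exact sum_ttTmul_eq S (h X) (h X') t φ m
  · rw [← cls_eq, lift_cls, hδ]
    have h₁ := sum_ttTmul_eq S (h X) h' (𝟙 X) φ m
    simp only [clsLin_transpose, RBimod.toLin_map_id] at h₁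
    exact h₁

variable {S} {N : Coend F →ₗ[k] TT (bimod F) (bimod F)} (hC : IsRightRigidCat C)

include hC in
-- Since $\widehat{ma}=\hat m a$, the action $\tau(a)$ from the right becomes $\sigma(a)$ on $h_-$.
-- This gives the balance needed in the second identity.
theorem IsOppNabla.map_tr (hN : IsOppNabla S N) (a : R) (h : Coend F) :
    N ((bimod F).tr a h) = srTT F a (N h) := by
  refine apply_eq_of_clsLin (N ∘ₗ (bimod F).tr a) (srTT F a ∘ₗ N) (fun X φ m => ?_) h
  obtain ⟨Y, ⟨_⟩⟩ := hC X
  obtain ⟨n, f, g, -, -, h⟩ := S.exists_coevaluation_eq Y X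
  rw [LinearMap.comp_apply, LinearMap.comp_apply, bimod_tr, hN X Y _ _ n f g h,
    hN X Y _ m n f g h, map_sum]
  simp only [srTT_ttTmul, bimod_sr, S.pairingLin_op_smul]

include hC in
theorem IsOppNabla.rmulTS_comul (hN : IsOppNabla S N) {h : Coend F} {Z : Coend F ⊗[k] Coend F}
    (hZ : mkTT (bimod F) (bimod F) Z = N h) :
    TensorProduct.lift ((rmulTS S).compl₂ (comul hF)) Z = tsTmul F h (one S) := by
  have hφ (a : R) (x y : Coend F) :
      TensorProduct.lift ((rmulTS S).compl₂ (comul hF)) ((bimod F).tr a x ⊗ₜ[k] y) =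
        TensorProduct.lift ((rmulTS S).compl₂ (comul hF)) (x ⊗ₜ[k] (bimod F).tl a y) := by
    simp only [TensorProduct.lift.tmul, LinearMap.compl₂_apply]
    rw [rmulTS_tr, (comul_isHom hF).map_tl]
  have hT (x y : Coend F) : Bal.lift _ hφ (ttTmul F x y) = rmulTS S x (comul hF y) :=
    (Bal.lift_tmul _ hφ x y).trans (TensorProduct.lift.tmul x y)
  rw [Bal.lift_of_mk_eq hφ hZ]
  generalize Bal.lift _ hφ = T at hT
  refine apply_eq_of_clsLin (T ∘ₗ N) ((tsTmul F).flip (one S)) (fun X φ m => ?_) h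
  obtain ⟨Y, ⟨_⟩⟩ := hC X
  obtain ⟨n, f, g, hfg, h₁, h₂⟩ := S.exists_coevaluation_eq Y X
  obtain ⟨l, b, b', hb⟩ := (hF X).exists_isDualBasis
  rw [LinearMap.comp_apply, hN X Y _ m n f g h₂]
  simp only [map_sum, hT, comul_clsLin hF hb, rmulTS_tsTmul, mul_clsLin]
  rw [Finset.sum_comm]
  conv_rhs => rw [hb m]
  simp only [map_sum, LinearMap.flip_apply]
  refine Finset.sum_congr rfl fun i _ => ?_
  -- Now $\mathrm{db}$ serves the first identity: $\sum\theta(f_j\otimes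
  -- g_j)=F(\mathrm{db})\eta^{-1}(1)$, and the collapse leaves $\sum_j b^i(\hat m(f_j)g_j)=b^i(m)$.
  have h₃ : S.dualMul Y X (S.pairingLin (ε_ Y X) m) (b' i)
      (RBimod.toLin (F.map (η_ Y X)) (S.unit 1)) = b' i m := by
    simp only [hfg, map_sum, S.dualMul_tmul]
    rw [← map_sum, h₁]
  rw [← bimod_tr, tsTmul_tr, ← h₃, ← clsLin_map_unit, hfg]
  simp only [map_sum]

include hC in
theorem IsOppNabla.lmulTT_nabla (hN : IsOppNabla S N) {h : Coend F} {Z : Coend F ⊗[k] Coend F}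
    (hZ : mkTS (bimod F) (bimod F) Z = comul hF h) :
    TensorProduct.lift ((lmulTT S).compl₂ N).flip Z = ttTmul F (one S) h := by
  have hφ (a : R) (x y : Coend F) :
      TensorProduct.lift ((lmulTT S).compl₂ N).flip ((bimod F).tr a x ⊗ₜ[k] y) =
        TensorProduct.lift ((lmulTT S).compl₂ N).flip (x ⊗ₜ[k] (bimod F).sl a y) := by
    simp only [TensorProduct.lift.tmul, LinearMap.flip_apply, LinearMap.compl₂_apply]
    rw [lmulTT_sl, hN.map_tr hC]
  have hT (x y : Coend F) : Bal.lift _ hφ (tsTmul F x y) = lmulTT S y (N x) :=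
    (Bal.lift_tmul _ hφ x y).trans (TensorProduct.lift.tmul x y)
  rw [Bal.lift_of_mk_eq hφ hZ]
  generalize Bal.lift _ hφ = T at hT
  refine apply_eq_of_clsLin (T ∘ₗ comul hF) (ttTmul F (one S)) (fun X φ m => ?_) h
  obtain ⟨Y, ⟨_⟩⟩ := hC X
  obtain ⟨n, f, g, -, h₁, h₂⟩ := S.exists_coevaluation_eq Y X
  obtain ⟨l, b, b', hb⟩ := (hF X).exists_isDualBasis
  rw [LinearMap.comp_apply, comul_clsLin hF hb]
  simp only [map_sum, hT, hN X Y _ _ n f g h₂, lmulTT_ttTmul, mul_clsLin]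
  rw [Finset.sum_comm]
  conv_rhs => rw [← h₁ m]
  simp only [map_sum]
  refine Finset.sum_congr rfl fun j _ => ?_
  -- The sum over $i$ has functional $\eta F(\mathrm{ev})$ and collapses to $1\,\tau(\hat m(f_j))$;
  -- the scalar crosses to $g_j$, and $\sum\hat m(f_j)g_j=m$.
  rw [← bimod_tl, ← ttTmul_tr, S.pairingLin_apply, ← clsLin_transpose_counit,
    ← S.sum_dualMul_pairing _ hb]
  simp only [map_sum, LinearMap.sum_apply]

/-- The opposite antipode on the coend. -/
noncomputable def oppAntipode (hN : IsOppNabla S N) : (bialgebroid S hF).OppAntipode where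
  nabla := N
  nabla_Δ h Z hZ := by
    rw [bialgebroid_mulTSr]
    exact hN.rmulTS_comul hF hC hZ
  Δ_nabla h Z hZ := by
    rw [bialgebroid_mulTT]
    exact hN.lmulTT_nabla hF hC hZ

end Coend

end OppositeAntipode

end Tannaka

theorem theorem2p2p4 {k : Type u} {R : Type w} [CommRing k] [Ring R] [Algebra k R]
    {C : Type v₁} [Category.{v₂} C] [MonoidalCategory C]
    (F : C ⥤ RBimod k R) (S : MonoidalStr F) (hF : ∀ X, (F.obj X).IsLeftRigid) :
    ∃ B : Bialgebroid (Coend.bimod F),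
      -- the coproduct `Δ[φ ⊗ m] = ∑ [φ ⊗ m_i] ⊗ [φ^i ⊗ m]` and the counit `ε[φ ⊗ m] = φ(m)`
      (∀ (X : C) (φ : (F.obj X).Dual) (m : F.obj X) (n : ℕ) (e : Fin n → F.obj X)
        (e' : Fin n → (F.obj X).Dual), (F.obj X).IsDualBasis e e' →
        B.Δ (Coend.cls F X φ m) = ∑ i, DoubleBimod.mkTS _ _
          (Coend.cls F X φ (e i) ⊗ₜ[k] Coend.cls F X (e' i) m)) ∧
      (∀ (X : C) (φ : (F.obj X).Dual) (m : F.obj X), B.ε (Coend.cls F X φ m) = φ m) ∧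
      -- the product, induced by the isomorphisms `θ`
      (∀ (X Y : C) (φ : (F.obj X).Dual) (m : F.obj X) (ψ : (F.obj Y).Dual) (n : F.obj Y),
        B.mul (Coend.cls F X φ m) (Coend.cls F Y ψ n) =
          Coend.cls F (X ⊗ Y) (RBimod.transpose (S.θ X Y).inv (RBimod.dualTens φ ψ))
            (RBimod.app₂ (S.θ X Y).hom m n)) ∧
      -- the unit, induced by the isomorphism `η : F(I) ≅ R`
      (∀ a b : R, B.u (a ⊗ₜ[k] b) =
        Coend.cls F (𝟙_ C) ((F.obj (𝟙_ C)).dualL a (RBimod.toDual S.η.hom))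
          (RBimod.toLin S.η.inv b)) ∧
      -- the antipode, if `C` is left rigid; here `Y` is a left dual of `X`, and `F(Y)` is
      -- identified with `F(X)^*`
      (IsLeftRigidCat C → ∃ A : B.Antipode,
        ∀ (X Y : C) [ExactPairing X Y] (ξ : F.obj Y) (m : F.obj X) (n : ℕ)
          (e : Fin n → F.obj Y) (e' : Fin n → (F.obj Y).Dual), (F.obj Y).IsDualBasis e e' →
          A.nabla (Coend.cls F X (S.pairing (ε_ X Y) ξ) m) = ∑ j, DoubleBimod.mkSS _ _
            (Coend.cls F Y (e' j) ξ ⊗ₜ[k] Coend.cls F X (S.pairing (ε_ X Y) (e j)) m)) ∧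
      -- the opposite antipode, if `C` is right rigid; here `Y` is a right dual of `X`, and `F(X)`
      -- is identified with `F(Y)^*`
      (IsRightRigidCat C → ∃ A : B.OppAntipode,
        ∀ (X Y : C) [ExactPairing Y X] (φ : (F.obj X).Dual) (m : F.obj X) (n : ℕ)
          (f : Fin n → F.obj Y) (g : Fin n → F.obj X),
          (F.obj Y).IsDualBasis f (fun j => S.pairing (ε_ Y X) (g j)) →
          A.nabla (Coend.cls F X φ m) = ∑ j, DoubleBimod.mkTT _ _
            (Coend.cls F Y (S.pairing (ε_ Y X) m) (f j) ⊗ₜ[k] Coend.cls F X φ (g j))) := by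
  refine ⟨Coend.bialgebroid S hF, fun X φ m n e e' h => Coend.comul_clsLin hF h φ m,
    Coend.counit_clsLin, Coend.mul_clsLin S, Coend.unit_tmul S, fun hC => ?_, fun hC => ?_⟩
  · obtain ⟨N, hN⟩ := Coend.exists_isNabla S hF hC
    exact ⟨Coend.antipode hF hC hN, hN⟩
  · obtain ⟨N, hN⟩ := Coend.exists_isOppNabla S hC
    exact ⟨Coend.oppAntipode hF hC hN, hN⟩
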